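/- **Setting.** Let $\mathcal A$ be a finite action set with $A=|\mathcal A|\ge 1$, let $\beta>0$, $r_{\max}>0$, let $r^\star:\mathcal A\to[0,r_{\max}]$ be the unknown reward, and let $\pi_{\mathsf{ref}}$ be a policy (a probability distribution on $\mathcal A$) with $\pi_{\mathsf{ref}}(a)>0$ for all $a$. Write $\sigma(x)=(1+e^{-x})^{-1}$, $\pi_{\mathsf{HF}}(a)=e^{r^\star(a)}/\sum_{a'}e^{r^\star(a')}$, and for policies $\pi,\pi_{\mathsf{cal}}$ and $r:\mathcal A\to\mathbb R$ $$J(\pi,r;\pi_{\mathsf{cal}})=\mathbb E_{a\sim\pi}[r(a)]-\mathbb E_{a\sim\pi_{\mathsf{cal}}}[r(a)]-\beta\,\mathsf{KL}(\pi\,\|\,\pi_{\mathsf{ref}}),\qquad J^\star(r;\pi_{\mathsf{cal}})=\max_\pi J(\pi,r;\pi_{\mathsf{cal}}).$$ **Algorithm.** Given deterministic initial policies $\pi^{(0)},\pi^{(1)}$ and parameters $\alpha_1,\dots,\alpha_T$, in each iteration $t=1,\dots,T$: conditionally on the past, draw independently $a_1^t\sim\pi^{(t-1)}$ and $a_2^t\sim\pi^{(t)}$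 and observe a comparison in which $a_1^t\succ a_2^t$ with probability $\sigma(r^\star(a_1^t)-r^\star(a_2^t))$ and $a_2^t\succ a_1^t$ otherwise; let $a_+^t$ be the preferred and $a_-^t$ the rejected action. Then, with $\ell(r,\mathcal D^{(t)})=\sum_{i=1}^t\log\sigma(r(a_+^i)-r(a_-^i))$, choose $$r^{(t+1)}\in\mathop{\arg\max}_{r:\mathcal A\to[0,r_{\max}]}\ \ell(r,\mathcal D^{(t)})+\alpha_tJ^\star(r;\pi^{(t)}),\qquad \pi^{(t+1)}=\mathop{\arg\max}_{\pi}J(\pi,r^{(t+1)};\pi^{(t)}),$$ ties being broken arbitrarily (possibly at random, without knowledge of future samples). The regret is $\mathcal R(T)=\sum_{t=1}^T[J(\pi^\star,r^\star;\pi_{\mathsf{cal}})-J(\pi^{(t)},r^\star;\pi_{\mathsf{cal}})]$ with $\pi^\star=\arg\max_\pi J(\pi,r^\star;\pi_{\mathsf{cal}})$; it does not depend on the policy $\pi_{\mathsf{cal}}$. **Theorem 1.** For every $r_0>0$ there are constants $C,K>0$, depending on $r_0$ only (so universal when, for example, $r_{\max}\ge 1$), such that the following holds for all $T\ge1$, all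 $\mathcal A,\beta,r^\star,\pi_{\mathsf{ref}}$ as above, all $r_{\max}\ge r_0$, and all initial policies with $\beta\,\mathsf{KL}(\pi^{(1)}\|\pi_{\mathsf{ref}})\le r_{\max}$ (for instance $\pi^{(1)}=\pi_{\mathsf{ref}}$, or $\pi^{(1)}\propto\pi_{\mathsf{ref}}\,e^{r/\beta}$ with $r:\mathcal A\to[0,r_{\max}]$). If $\alpha_1\le\dots\le\alpha_T$ and $\alpha_t>A\log T$ for all $t$, then with probability at least $1-KT^{-10}$ $$\begin{aligned}\mathcal R(T)\le{}&C r_{\max}A^2\sqrt{T\log T}+C\sum_{t=1}^T\frac{A\,r_{\max}\log T}{\alpha_t}+CA^2\alpha_Tr_{\max}^2\\&+C(r_{\max}+\log T)\sum_{(a_+,a_-):\,r^\star(a_+)\ge r^\star(a_-)}\min\left\{\frac{\pi_{\mathsf{HF}}(a_+)}{\pi_{\mathsf{HF}}(a_-)}\alpha_Tr_{\max},\ \left(T\frac{\pi_{\mathsf{ref}}(a_-)}{\pi_{\mathsf{ref}}(a_+)}\right)^{\frac{\beta}{\beta+1}}\alpha_T^{\frac1{\beta+1}}r_{\max}^{\frac1{\beta+1}}\right\},\end{aligned}$$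 where the last sum runs over ordered pairs of actions. -/

import Mathlib

open MeasureTheory

namespace RLHF

variable {A : Type*}

/-- One round of data: the two sampled actions `(a₁, a₂)` and the oracle's answer,
`true` meaning `a₁ ≻ a₂` and `false` meaning `a₂ ≻ a₁`. -/
abbrev Sample (A : Type*) : Type _ := A × A × Bool

/-- The preferred action `a₊` of a round. -/
def Sample.winner (o : Sample A) : A := if o.2.2 then o.1 else o.2.1

/-- The rejected action `a₋` of a round. -/
def Sample.loser (o : Sample A) : A := if o.2.2 then o.2.1 else o.1

/-- Reward functions `r : A → [0, rmax]`. -/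
def rewardClass (A : Type*) (rmax : ℝ) : Set (A → ℝ) := {r | ∀ a, 0 ≤ r a ∧ r a ≤ rmax}

/-- Log-likelihood `ℓ(r, D⁽ᵗ⁾)` of `r` under the Bradley-Terry model, for the data of the
rounds `1, …, t`. -/
noncomputable def logLik (D : ℕ → Sample A) (t : ℕ) (r : A → ℝ) : ℝ :=
  ∑ i ∈ Finset.Icc 1 t, Real.log (Real.sigmoid (r (D i).winner - r (D i).loser))

/-- Probability of the outcome `o` of a round in which `a₁ ∼ p` and `a₂ ∼ q` are drawn
independently and compared by a Bradley-Terry oracle with reward `rstar`. -/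
noncomputable def roundProb (rstar p q : A → ℝ) (o : Sample A) : ℝ :=
  p o.1 * q o.2.1 * Real.sigmoid (rstar o.winner - rstar o.loser)

variable [Fintype A]

/-- Kullback-Leibler divergence `KL(p ‖ q)` on a finite set, for `q` positive everywhere. -/
noncomputable def kl (p q : A → ℝ) : ℝ := ∑ a, p a * Real.log (p a / q a)

/-- The policy `π_HF` describing human preference. -/
noncomputable def humanPolicy (rstar : A → ℝ) (a : A) : ℝ :=
  Real.exp (rstar a) / ∑ b, Real.exp (rstar b)

/-- The KL-regularized objective `J(p, r; cal)`. -/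
noncomputable def objJ (β : ℝ) (piRef : A → ℝ) (p r cal : A → ℝ) : ℝ :=
  ∑ a, p a * r a - ∑ a, cal a * r a - β * kl p piRef

/-- The optimal value `J⋆(r; cal)`: the maximum of `J(p, r; cal)` over all policies `p`. -/
noncomputable def optJ (β : ℝ) (piRef : A → ℝ) (r cal : A → ℝ) : ℝ :=
  sSup ((fun p => objJ β piRef p r cal) '' stdSimplex ℝ A)

/-- A run of `T` iterations of uncertainty-based exploration on the probability space `(Ω, μ)`:
`D t` is the data of round `t`, `r t` the reward estimate, `π t` the policy, and `ℱ t` the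
information available after iteration `t`. Ties in the choice of a maximizer may be
broken in any way, also at random. -/
structure IsExplorationRun {Ω : Type*} {m : MeasurableSpace Ω} (μ : Measure Ω)
    (ℱ : Filtration ℕ m) (T : ℕ) (β rmax : ℝ) (α : ℕ → ℝ)
    (rstar piRef piZero piOne : A → ℝ) (D : ℕ → Ω → Sample A) (r π : ℕ → Ω → A → ℝ) : Prop where
  init_zero : ∀ ω, π 0 ω = piZero
  init_one : ∀ ω, π 1 ω = piOne
  /-- The comparison made in iteration `t` is known after iteration `t`. -/
  data_meas : ∀ t, 1 ≤ t → t ≤ T → ∀ o, MeasurableSet[ℱ t] {ω | D t ω = o}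
  /-- The updated reward and policy are known after iteration `t`. -/
  reward_meas : ∀ t, 1 ≤ t → t ≤ T → ∀ a, Measurable[ℱ t] fun ω => r (t + 1) ω a
  policy_meas : ∀ t, 1 ≤ t → t ≤ T → ∀ a, Measurable[ℱ t] fun ω => π (t + 1) ω a
  /-- Iteration `t`, given the past: `a₁ ∼ π⁽ᵗ⁻¹⁾` and `a₂ ∼ π⁽ᵗ⁾` independently, then a
  Bradley-Terry comparison. -/
  data_law : ∀ t, 1 ≤ t → t ≤ T → ∀ o,
    μ[Set.indicator {ω | D t ω = o} (fun _ => (1 : ℝ)) | ℱ (t - 1)]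
      =ᵐ[μ] fun ω => roundProb rstar (π (t - 1) ω) (π t ω) o
  /-- `r⁽ᵗ⁺¹⁾` maximizes `ℓ(r, D⁽ᵗ⁾) + αₜ J⋆(r; π⁽ᵗ⁾)` over `r : A → [0, rmax]`. -/
  reward_mem : ∀ t, 1 ≤ t → t ≤ T → ∀ ω, r (t + 1) ω ∈ rewardClass A rmax
  reward_max : ∀ t, 1 ≤ t → t ≤ T → ∀ ω, IsMaxOn
    (fun r' => logLik (fun i => D i ω) t r' + α t * optJ β piRef r' (π t ω))
    (rewardClass A rmax) (r (t + 1) ω)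
  /-- `π⁽ᵗ⁺¹⁾` maximizes `J(p, r⁽ᵗ⁺¹⁾; π⁽ᵗ⁾)` over all policies `p`. -/
  policy_mem : ∀ t, 1 ≤ t → t ≤ T → ∀ ω, π (t + 1) ω ∈ stdSimplex ℝ A
  policy_max : ∀ t, 1 ≤ t → t ≤ T → ∀ ω, IsMaxOn
    (fun p => objJ β piRef p (r (t + 1) ω) (π t ω)) (stdSimplex ℝ A) (π (t + 1) ω)

/-- Cumulative regret of the policies `π 1, …, π T` against `piStar`, measured under the reward
`rstar` with calibration policy `cal`. -/
noncomputable def regret (T : ℕ) (β : ℝ) (piRef rstar cal piStar : A → ℝ) (π : ℕ → A → ℝ) : ℝ :=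
  ∑ t ∈ Finset.Icc 1 T, (objJ β piRef piStar rstar cal - objJ β piRef (π t) rstar cal)

end RLHF

open RLHF

/-!
The estimates are optimistic: since `r⁽ᵗ⁺¹⁾` maximizes the penalized likelihood, the regret of round
`t + 1` is at most the error of `r⁽ᵗ⁺¹⁾` on reward differences, averaged over the very pairs that
round `t + 1` samples, plus `(ℓ(r⁽ᵗ⁺¹⁾) - ℓ(r⋆)) / αₜ` (`objJ_sub_le_of_optimistic`).

The exponential of half the log-likelihood ratio, compensated by the cumulated Hellinger distance
`infoGain` of the comparison laws, is a supermartingale (`likProcess_supermartingale`). A union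
bound over a grid of rewards therefore shows that, with probability at least `1 - T⁻¹⁰`, the excess
log-likelihood of every reward is at most `34 A log T` minus twice its information gain
(`measureReal_not_confidence_le`). The first part sums to the second term of the bound; the second
part is a penalty against which the errors are played off, one pair of actions at a time.

Let `x ≥ 0` be the true gap of a pair, `y` an estimate of it, and `n` the mass that the pair has
received so far.

* The Hellinger distance is at least of order `e⁻ˣ min(1, (y - x)²)`
  (`exp_neg_mul_min_le_hellinger`), so the penalty `n e⁻ˣ min(1, (y - x)²) / α` cancels large errors
  once `n` is of order `eˣ α rmax`, and leaves a logarithmic sum for small ones. This gives the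
  first entry of the minimum (`sum_pair_le_exp`).
* If `x > Y + 1`, an estimate `y ≤ Y` has Hellinger distance at least of order `min(1, exp (-Y))`
  (`min_exp_neg_le_hellinger`), so such estimates are affordable up to a mass of
  order `(1 + exp Y) α rmax`. While the estimates exceed `Y`, the Gibbs form of the policies keeps
  the probability of the worse action below `exp (-Y / β) πref(a₋) / πref(a₊)`
  (`le_ratio_mul_exp_of_isMaxOn`). Since the comparison in a round uses two consecutive policies, a
  round is charged to the estimate of the same or of the preceding round (`sum_pair_le_threshold`).
  Balancing the two masses in `Y` gives the second entry (`sum_pair_le_min`).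

The grid has logarithmic cardinality of order `A log T` only for `rmax ≤ T`. For `rmax > T` the
regret, at most `2 rmax` per round, is below the third term of the bound.
-/

namespace RLHF

/-! ### Bernoulli laws with logistic parameter -/

/-- The Bhattacharyya affinity of the Bernoulli laws with parameters `σ(x)` and `σ(y)`. -/
noncomputable def affinity (x y : ℝ) : ℝ :=
  √(Real.sigmoid x) * √(Real.sigmoid y) + √(Real.sigmoid (-x)) * √(Real.sigmoid (-y))

/-- The squared Hellinger distance of the Bernoulli laws with parameters `σ(x)` and `σ(y)`,
normalized to lie in `[0, 1]`. -/
noncomputable def hellinger (x y : ℝ) : ℝ := 1 - affinity x y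

lemma affinity_nonneg (x y : ℝ) : 0 ≤ affinity x y := by unfold affinity; positivity

lemma hellinger_le_one (x y : ℝ) : hellinger x y ≤ 1 := by
  have := affinity_nonneg x y; unfold hellinger; linarith

lemma hellinger_neg (x y : ℝ) : hellinger (-x) (-y) = hellinger x y := by
  simp only [hellinger, affinity, neg_neg]; ring

lemma hellinger_comm (x y : ℝ) : hellinger x y = hellinger y x := by
  simp only [hellinger, affinity]; ring

lemma sqrt_sigmoid (x : ℝ) :
    √(Real.sigmoid x) = Real.exp (x / 2) / √(1 + Real.exp (x / 2) ^ 2) := by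
  have h : Real.sigmoid x = Real.exp (x / 2) ^ 2 / (1 + Real.exp (x / 2) ^ 2) := by
    have h1 : Real.exp (x / 2) ^ 2 = Real.exp x := by
      rw [← Real.exp_nat_mul]; congr 1; push_cast; ring
    rw [h1, Real.sigmoid_def, Real.exp_neg]
    have := Real.exp_pos x
    field_simp
    ring
  rw [h, Real.sqrt_div (by positivity), Real.sqrt_sq (Real.exp_pos _).le]

lemma sqrt_sigmoid_neg (x : ℝ) :
    √(Real.sigmoid (-x)) = 1 / √(1 + Real.exp (x / 2) ^ 2) := by
  have h : Real.sigmoid (-x) = 1 / (1 + Real.exp (x / 2) ^ 2) := by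
    have h1 : Real.exp (x / 2) ^ 2 = Real.exp x := by
      rw [← Real.exp_nat_mul]; congr 1; push_cast; ring
    rw [h1, Real.sigmoid_def, neg_neg, one_div]
  rw [h, Real.sqrt_div (by positivity), Real.sqrt_one]

/-- With `p = exp (x / 2)` and `q = exp (y / 2)`, the affinity is
`(1 + p q) / √((1 + p²) (1 + q²))`. -/
lemma one_sub_affinity_sq (x y : ℝ) :
    1 - affinity x y ^ 2 = (Real.exp (x / 2) - Real.exp (y / 2)) ^ 2 /
      ((1 + Real.exp (x / 2) ^ 2) * (1 + Real.exp (y / 2) ^ 2)) := by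
  unfold affinity
  rw [sqrt_sigmoid, sqrt_sigmoid, sqrt_sigmoid_neg, sqrt_sigmoid_neg]
  set p := Real.exp (x / 2)
  set q := Real.exp (y / 2)
  have hp : 0 < 1 + p ^ 2 := by positivity
  have hq : 0 < 1 + q ^ 2 := by positivity
  have e : p / √(1 + p ^ 2) * (q / √(1 + q ^ 2)) + 1 / √(1 + p ^ 2) * (1 / √(1 + q ^ 2))
      = (p * q + 1) / (√(1 + p ^ 2) * √(1 + q ^ 2)) := by
    field_simp
  rw [e, div_pow, mul_pow, Real.sq_sqrt hp.le, Real.sq_sqrt hq.le]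
  field_simp
  ring

lemma affinity_le_one (x y : ℝ) : affinity x y ≤ 1 := by
  have h := one_sub_affinity_sq x y
  have h2 : 0 ≤ 1 - affinity x y ^ 2 := by rw [h]; positivity
  nlinarith [affinity_nonneg x y]

lemma hellinger_nonneg (x y : ℝ) : 0 ≤ hellinger x y := by
  have := affinity_le_one x y; unfold hellinger; linarith

lemma half_le_hellinger (x y : ℝ) :
    (Real.exp (x / 2) - Real.exp (y / 2)) ^ 2 /
      ((1 + Real.exp (x / 2) ^ 2) * (1 + Real.exp (y / 2) ^ 2)) / 2 ≤ hellinger x y := by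
  rw [← one_sub_affinity_sq]
  unfold hellinger
  nlinarith [sq_nonneg (1 - affinity x y)]

lemma min_le_one_sub_exp_sq {D : ℝ} (hD : 0 ≤ D) :
    min 1 (D ^ 2) / 9 ≤ (1 - Real.exp (-D / 2)) ^ 2 := by
  have h1 : Real.exp (-D / 2) ≤ 1 / (1 + D / 2) := by
    rw [show -D / 2 = -(D / 2) by ring, Real.exp_neg, ← one_div]
    apply one_div_le_one_div_of_le (by positivity)
    have := Real.add_one_le_exp (D / 2); linarith
  rcases le_total D 1 with h | h
  · have h2 : D / 3 ≤ 1 - Real.exp (-D / 2) := by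
      have : 1 / (1 + D / 2) ≤ 1 - D / 3 := by
        rw [div_le_iff₀ (by positivity)]; nlinarith
      linarith
    calc min 1 (D ^ 2) / 9 ≤ D ^ 2 / 9 := by gcongr; exact min_le_right _ _
      _ = (D / 3) ^ 2 := by ring
      _ ≤ _ := by gcongr
  · have h2 : 1 / 3 ≤ 1 - Real.exp (-D / 2) := by
      have : 1 / (1 + D / 2) ≤ 1 - 1 / 3 := by
        rw [div_le_iff₀ (by positivity)]; nlinarith
      linarith
    calc min 1 (D ^ 2) / 9 ≤ 1 / 9 := by gcongr; exact min_le_left _ _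
      _ = (1 / 3) ^ 2 := by norm_num
      _ ≤ _ := by gcongr

/-- The Hellinger distance sees a gap at `x ≥ 0` at the scale `e⁻ˣ` of the probability that the
worse action wins. -/
lemma exp_neg_mul_min_le_hellinger {x : ℝ} (hx : 0 ≤ x) (y : ℝ) :
    Real.exp (-x) * min 1 (|y - x| ^ 2) / 72 ≤ hellinger x y := by
  refine le_trans ?_ (half_le_hellinger x y)
  have hm := min_le_one_sub_exp_sq (abs_nonneg (y - x))
  have hex : Real.exp (-x) = 1 / Real.exp (x / 2) ^ 2 := by
    rw [← Real.exp_nat_mul, Real.exp_neg, one_div]; congr 2; push_cast; ring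
  have hp1 : 1 ≤ Real.exp (x / 2) := Real.one_le_exp (by positivity)
  have key : Real.exp (-x) * (1 - Real.exp (-|y - x| / 2)) ^ 2 / 4 ≤
      (Real.exp (x / 2) - Real.exp (y / 2)) ^ 2 /
      ((1 + Real.exp (x / 2) ^ 2) * (1 + Real.exp (y / 2) ^ 2)) := by
    rw [hex]
    set p := Real.exp (x / 2) with hp
    set q := Real.exp (y / 2) with hq
    have hq0 : 0 < q := Real.exp_pos _
    have hp0 : 0 < p := Real.exp_pos _
    rcases le_total x y with h | h
    · have e : Real.exp (-|y - x| / 2) = p / q := by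
        rw [abs_of_nonneg (by linarith), hp, hq, ← Real.exp_sub]; congr 1; ring
      have hpq : p ≤ q := Real.exp_le_exp.2 (by linarith)
      rw [e]
      have e2 : 1 / p ^ 2 * (1 - p / q) ^ 2 / 4 = (p - q) ^ 2 / ((2 * p ^ 2) * (2 * q ^ 2)) := by
        field_simp; ring
      rw [e2]
      gcongr <;> nlinarith
    · have e : Real.exp (-|y - x| / 2) = q / p := by
        rw [abs_of_nonpos (by linarith), hp, hq, ← Real.exp_sub]; congr 1; ring
      have hpq : q ≤ p := Real.exp_le_exp.2 (by linarith)
      rw [e]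
      have e2 : 1 / p ^ 2 * (1 - q / p) ^ 2 / 4 = (p - q) ^ 2 / ((2 * p ^ 2) * (2 * p ^ 2)) := by
        field_simp; ring
      rw [e2]
      gcongr <;> nlinarith
  have : Real.exp (-x) * (min 1 (|y - x| ^ 2) / 9) ≤
    Real.exp (-x) * (1 - Real.exp (-|y - x| / 2)) ^ 2 := by gcongr
  linarith

/-- An estimate `y` at least `1` below the true gap `x ≥ 0` is detected at the scale of the
estimated gap, no matter how large `x` is. -/
lemma min_exp_neg_le_hellinger {x y Y : ℝ} (hx : 0 ≤ x) (hy : y ≤ Y) (hY : Y + 1 ≤ x) :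
    min 1 (Real.exp (-Y)) / 72 ≤ hellinger x y := by
  rcases le_total 0 y with h0 | h0
  · have h := exp_neg_mul_min_le_hellinger h0 x
    rw [hellinger_comm] at h
    refine le_trans ?_ h
    have h1 : (1 : ℝ) ≤ |x - y| ^ 2 := by
      rw [sq_abs]; nlinarith
    rw [min_eq_left h1, mul_one]
    gcongr
    exact (min_le_right _ _).trans (Real.exp_le_exp.2 (by linarith))
  · refine le_trans ?_ (half_le_hellinger x y)
    have hm := min_le_one_sub_exp_sq (show (0 : ℝ) ≤ x - y by linarith)
    rw [min_eq_left (by nlinarith)] at hm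
    have e : Real.exp (-(x - y) / 2) = Real.exp (y / 2) / Real.exp (x / 2) := by
      rw [← Real.exp_sub]; congr 1; ring
    have hp1 : 1 ≤ Real.exp (x / 2) := Real.one_le_exp (by positivity)
    have hq1 : Real.exp (y / 2) ≤ 1 := Real.exp_le_one_iff.2 (by linarith)
    rw [e] at hm
    set p := Real.exp (x / 2) with hp
    set q := Real.exp (y / 2) with hq
    have hq0 : 0 < q := Real.exp_pos _
    have hp0 : 0 < p := Real.exp_pos _
    have key : (1 - q / p) ^ 2 / 4 ≤ (p - q) ^ 2 / ((1 + p ^ 2) * (1 + q ^ 2)) := by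
      have e2 : (1 - q / p) ^ 2 / 4 = (p - q) ^ 2 / ((2 * p ^ 2) * 2) := by
        field_simp; ring
      rw [e2]
      gcongr <;> nlinarith
    have := min_le_left 1 (Real.exp (-Y))
    linarith

lemma sigmoid_le_exp_mul_sigmoid {y y' ε : ℝ} (hε : 0 ≤ ε) (h : y ≤ y' + ε) :
    Real.sigmoid y ≤ Real.exp ε * Real.sigmoid y' := by
  have h1 : Real.sigmoid y ≤ Real.sigmoid (y' + ε) := Real.sigmoid_le h
  refine h1.trans ?_
  rw [Real.sigmoid_def, Real.sigmoid_def, ← div_eq_mul_inv, ← one_div,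
    div_le_div_iff₀ (by positivity) (by positivity)]
  have : Real.exp (-y') = Real.exp ε * Real.exp (-(y' + ε)) := by
    rw [← Real.exp_add]; congr 1; ring
  have h2 := Real.one_le_exp hε
  rw [this]; linarith

lemma log_sigmoid_le {y y' ε : ℝ} (hε : 0 ≤ ε) (h : y ≤ y' + ε) :
    Real.log (Real.sigmoid y) ≤ Real.log (Real.sigmoid y') + ε := by
  have := Real.log_le_log (Real.sigmoid_pos y) (sigmoid_le_exp_mul_sigmoid hε h)
  rw [Real.log_mul (Real.exp_pos _).ne' (Real.sigmoid_pos _).ne', Real.log_exp] at this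
  linarith

lemma sqrt_sigmoid_le {y y' ε : ℝ} (hε : 0 ≤ ε) (h : y ≤ y' + ε) :
    √(Real.sigmoid y) ≤ Real.exp (ε / 2) * √(Real.sigmoid y') := by
  have e : Real.exp (ε / 2) = √(Real.exp ε) := Real.exp_half ε
  rw [e, ← Real.sqrt_mul (Real.exp_pos _).le]
  exact Real.sqrt_le_sqrt (sigmoid_le_exp_mul_sigmoid hε h)

lemma hellinger_le_of_abs_sub_le {x y y' ε : ℝ} (hε1 : ε ≤ 1) (h : |y' - y| ≤ ε) :
    hellinger x y ≤ hellinger x y' + ε := by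
  have hε : 0 ≤ ε := (abs_nonneg _).trans h
  have hab := abs_le.1 h
  have h1 : affinity x y' ≤ Real.exp (ε / 2) * affinity x y := by
    unfold affinity
    have h1 := sqrt_sigmoid_le (y := y') (y' := y) hε (by linarith)
    have h2 := sqrt_sigmoid_le (y := -y') (y' := -y) hε (by linarith)
    have h3 := mul_le_mul_of_nonneg_left h1 (Real.sqrt_nonneg (Real.sigmoid x))
    have h4 := mul_le_mul_of_nonneg_left h2 (Real.sqrt_nonneg (Real.sigmoid (-x)))
    linarith
  have h2 : Real.exp (ε / 2) ≤ 1 + ε := by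
    have := Real.exp_bound_div_one_sub_of_interval (x := ε / 2) (by linarith) (by linarith)
    refine this.trans ?_
    rw [div_le_iff₀ (by linarith)]; nlinarith
  have := affinity_le_one x y
  have := affinity_nonneg x y
  unfold hellinger
  nlinarith

/-! ### Policies maximizing the regularized objective -/

lemma sub_le_mul_log_div {p q : ℝ} (hp : 0 ≤ p) (hq : 0 < q) : p - q ≤ p * Real.log (p / q) := by
  rcases hp.eq_or_lt with rfl | hp
  · simp [hq.le]
  · have h := Real.log_le_sub_one_of_pos (div_pos hq hp)
    have e : Real.log (p / q) = -Real.log (q / p) := by rw [← Real.log_inv, inv_div]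
    rw [e]
    have h2 := mul_le_mul_of_nonneg_left h hp.le
    have h3 : p * (q / p - 1) = q - p := by field_simp
    linarith

lemma eq_of_mul_log_div_le {p q : ℝ} (hp : 0 ≤ p) (hq : 0 < q)
    (h : p * Real.log (p / q) ≤ p - q) : p = q := by
  rcases hp.eq_or_lt with rfl | hp
  · simp at h; linarith
  · by_contra hne
    have hne' : q / p ≠ 1 := fun e => hne ((div_eq_one_iff_eq hp.ne').1 e).symm
    have h1 := Real.log_lt_sub_one_of_pos (div_pos hq hp) hne'
    have e : Real.log (p / q) = -Real.log (q / p) := by rw [← Real.log_inv, inv_div]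
    rw [e] at h
    have h2 := mul_lt_mul_of_pos_left h1 hp
    have h3 : p * (q / p - 1) = q - p := by field_simp
    linarith

section Policies

variable {A : Type*} [Fintype A]

lemma kl_nonneg {p q : A → ℝ} (hp : p ∈ stdSimplex ℝ A) (hq : q ∈ stdSimplex ℝ A)
    (hq0 : ∀ a, 0 < q a) : 0 ≤ kl p q := by
  have : ∑ a, (p a - q a) ≤ kl p q :=
    Finset.sum_le_sum fun a _ => sub_le_mul_log_div (hp.1 a) (hq0 a)
  rw [Finset.sum_sub_distrib, hp.2, hq.2] at this
  linarith

lemma kl_self (p : A → ℝ) : kl p p = 0 := by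
  refine Finset.sum_eq_zero fun a _ => ?_
  rcases eq_or_ne (p a) 0 with h | h
  · simp [h]
  · simp [div_self h]

lemma eq_of_kl_le_zero {p q : A → ℝ} (hp : p ∈ stdSimplex ℝ A) (hq : q ∈ stdSimplex ℝ A)
    (hq0 : ∀ a, 0 < q a) (h : kl p q ≤ 0) : p = q := by
  have h1 : ∀ a ∈ Finset.univ, 0 ≤ p a * Real.log (p a / q a) - (p a - q a) :=
    fun a _ => sub_nonneg.2 (sub_le_mul_log_div (hp.1 a) (hq0 a))
  have h2 : ∑ a, (p a * Real.log (p a / q a) - (p a - q a)) = kl p q := by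
    rw [Finset.sum_sub_distrib, Finset.sum_sub_distrib, hp.2, hq.2, kl]; ring
  have h3 := (Finset.sum_eq_zero_iff_of_nonneg h1).1
    (le_antisymm (h2 ▸ h) (Finset.sum_nonneg h1))
  funext a
  exact eq_of_mul_log_div_le (hp.1 a) (hq0 a) (by linarith [h3 a (Finset.mem_univ a)])

/-- The Gibbs policy `∝ piRef · exp (r / β)`. -/
noncomputable def gibbs (β : ℝ) (piRef r : A → ℝ) (a : A) : ℝ :=
  piRef a * Real.exp (r a / β) / ∑ b, piRef b * Real.exp (r b / β)

variable {β : ℝ} {piRef r : A → ℝ}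

lemma gibbs_norm_pos [Nonempty A] (h0 : ∀ a, 0 < piRef a) : 0 < ∑ b, piRef b * Real.exp (r b / β) :=
  Finset.sum_pos (fun b _ => mul_pos (h0 b) (Real.exp_pos _)) Finset.univ_nonempty

lemma gibbs_pos [Nonempty A] (h0 : ∀ a, 0 < piRef a) (a : A) : 0 < gibbs β piRef r a :=
  div_pos (mul_pos (h0 a) (Real.exp_pos _)) (gibbs_norm_pos h0)

lemma gibbs_mem [Nonempty A] (h0 : ∀ a, 0 < piRef a) : gibbs β piRef r ∈ stdSimplex ℝ A := by
  refine ⟨fun a => (gibbs_pos h0 a).le, ?_⟩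
  simp only [gibbs]
  rw [← Finset.sum_div, div_self (gibbs_norm_pos h0).ne']

/-- Gibbs variational identity. -/
lemma kl_gibbs [Nonempty A] (hβ : 0 < β) (h0 : ∀ a, 0 < piRef a) {p : A → ℝ}
    (hp : p ∈ stdSimplex ℝ A) :
    β * kl p (gibbs β piRef r) =
      β * Real.log (∑ b, piRef b * Real.exp (r b / β)) - (∑ a, p a * r a - β * kl p piRef) := by
  set Z := ∑ b, piRef b * Real.exp (r b / β) with hZ
  have hZ0 : 0 < Z := gibbs_norm_pos h0
  have h1 : ∀ a, p a * Real.log (p a / gibbs β piRef r a) =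
      p a * Real.log (p a / piRef a) - p a * r a / β + p a * Real.log Z := by
    intro a
    rcases eq_or_ne (p a) 0 with h | h
    · simp [h]
    · have e : p a / gibbs β piRef r a = p a / piRef a * Real.exp (-(r a / β)) * Z := by
        rw [gibbs, ← hZ, Real.exp_neg]
        have := h0 a
        field_simp
      have h2 : p a / piRef a ≠ 0 := div_ne_zero h (h0 a).ne'
      rw [e, Real.log_mul (mul_ne_zero h2 (Real.exp_pos _).ne') hZ0.ne',
        Real.log_mul h2 (Real.exp_pos _).ne', Real.log_exp]
      ring
  have h2 : kl p (gibbs β piRef r) = kl p piRef - (∑ a, p a * r a) / β + Real.log Z := by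
    unfold kl
    rw [Finset.sum_congr rfl fun a _ => h1 a, Finset.sum_add_distrib, Finset.sum_sub_distrib,
      ← Finset.sum_mul, hp.2, ← Finset.sum_div, one_mul]
  rw [h2]
  field_simp
  ring

lemma eq_gibbs_of_isMaxOn [Nonempty A] (hβ : 0 < β) (h0 : ∀ a, 0 < piRef a) {p cal : A → ℝ}
    (hp : p ∈ stdSimplex ℝ A)
    (hmax : IsMaxOn (fun p => objJ β piRef p r cal) (stdSimplex ℝ A) p) :
    p = gibbs β piRef r := by
  have hg := gibbs_mem (β := β) (r := r) h0
  refine eq_of_kl_le_zero hp hg (gibbs_pos h0) ?_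
  have h1 := hmax hg
  simp only [Set.mem_ofPred_eq, objJ] at h1
  have h2 := kl_gibbs (r := r) hβ h0 hp
  have h3 := kl_gibbs (r := r) hβ h0 hg
  rw [kl_self] at h3
  have h4 : β * kl p (gibbs β piRef r) ≤ 0 := by linarith
  by_contra hc
  have := mul_pos hβ (not_le.1 hc)
  linarith

lemma le_ratio_mul_exp_of_isMaxOn [Nonempty A] (hβ : 0 < β) (h0 : ∀ a, 0 < piRef a) {p cal : A → ℝ}
    (hp : p ∈ stdSimplex ℝ A)
    (hmax : IsMaxOn (fun p => objJ β piRef p r cal) (stdSimplex ℝ A) p) (a b : A) :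
    p b ≤ piRef b / piRef a * Real.exp (-((r a - r b) / β)) := by
  have he := eq_gibbs_of_isMaxOn hβ h0 hp hmax
  have h1 : gibbs β piRef r a ≤ 1 := by
    rw [← he, ← hp.2]
    exact Finset.single_le_sum (fun i _ => hp.1 i) (Finset.mem_univ a)
  have hZ := gibbs_norm_pos (β := β) (r := r) h0
  unfold gibbs at h1
  rw [he, gibbs]
  rw [div_le_one hZ] at h1
  have ha := h0 a
  have e : piRef b / piRef a * Real.exp (-((r a - r b) / β)) =
      piRef b * Real.exp (r b / β) / (piRef a * Real.exp (r a / β)) := by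
    rw [show -((r a - r b) / β) = r b / β - r a / β by ring, Real.exp_sub]
    field_simp
  rw [e]
  have := mul_pos ha (Real.exp_pos (r a / β))
  exact div_le_div_of_nonneg_left (mul_pos (h0 b) (Real.exp_pos _)).le this h1

lemma sum_mul_le_of_mem {p : A → ℝ} (hp : p ∈ stdSimplex ℝ A) {R : ℝ} (hr : r ∈ rewardClass A R) :
    ∑ a, p a * r a ≤ R := by
  calc ∑ a, p a * r a ≤ ∑ a, p a * R :=
        Finset.sum_le_sum fun a _ => mul_le_mul_of_nonneg_left (hr a).2 (hp.1 a)
    _ = R := by rw [← Finset.sum_mul, hp.2, one_mul]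

lemma sum_mul_nonneg_of_mem {p : A → ℝ} (hp : p ∈ stdSimplex ℝ A) {R : ℝ}
    (hr : r ∈ rewardClass A R) : 0 ≤ ∑ a, p a * r a :=
  Finset.sum_nonneg fun a _ => mul_nonneg (hp.1 a) (hr a).1

lemma mul_kl_le_of_isMaxOn (hRef : piRef ∈ stdSimplex ℝ A)
    {p cal : A → ℝ} (hp : p ∈ stdSimplex ℝ A) {R : ℝ} (hr : r ∈ rewardClass A R)
    (hmax : IsMaxOn (fun p => objJ β piRef p r cal) (stdSimplex ℝ A) p) :
    β * kl p piRef ≤ R := by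
  have h1 := hmax hRef
  simp only [Set.mem_ofPred_eq, objJ, kl_self] at h1
  have := sum_mul_le_of_mem hp hr
  have := sum_mul_nonneg_of_mem hRef hr
  linarith

lemma objJ_sub_le (hβ : 0 < β) (hRef : piRef ∈ stdSimplex ℝ A) (h0 : ∀ a, 0 < piRef a)
    {p piStar cal rstar : A → ℝ} (hp : p ∈ stdSimplex ℝ A) (hs : piStar ∈ stdSimplex ℝ A) {R : ℝ}
    (hr : rstar ∈ rewardClass A R) (hkl : β * kl p piRef ≤ R) :
    objJ β piRef piStar rstar cal - objJ β piRef p rstar cal ≤ 2 * R := by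
  unfold objJ
  have := sum_mul_le_of_mem hs hr
  have := sum_mul_nonneg_of_mem hp hr
  have := mul_nonneg hβ.le (kl_nonneg hs hRef h0)
  linarith

/-- Optimism: the per-round regret is at most the error of the estimated rewards on the pairs that
the next round samples, plus the scaled excess log-likelihood of the estimate. -/
lemma objJ_sub_le_of_optimistic
    {p p' piStar cal rstar r' : A → ℝ} (hp : p ∈ stdSimplex ℝ A) (hp' : p' ∈ stdSimplex ℝ A)
    (hs : piStar ∈ stdSimplex ℝ A)
    (hstar : IsMaxOn (fun p => objJ β piRef p rstar cal) (stdSimplex ℝ A) piStar)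
    (hmax : IsMaxOn (fun q => objJ β piRef q r' p) (stdSimplex ℝ A) p')
    {ll : (A → ℝ) → ℝ} {κ : ℝ} (hκ : 0 < κ)
    (hopt : ll rstar + κ * optJ β piRef rstar p ≤ ll r' + κ * optJ β piRef r' p) :
    objJ β piRef piStar rstar cal - objJ β piRef p' rstar cal ≤
      ∑ a, ∑ b, p a * p' b * |(r' a - r' b) - (rstar a - rstar b)| + (ll r' - ll rstar) / κ := by
  have h1 : optJ β piRef r' p = objJ β piRef p' r' p := by
    refine IsGreatest.csSup_eq ⟨⟨p', hp', rfl⟩, ?_⟩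
    rintro _ ⟨q, hq, rfl⟩
    exact hmax hq
  have h2 : objJ β piRef piStar rstar p ≤ optJ β piRef rstar p := by
    refine le_csSup ⟨objJ β piRef piStar rstar p, ?_⟩ ⟨piStar, hs, rfl⟩
    rintro _ ⟨q, hq, rfl⟩
    have := hstar hq
    simp only [Set.mem_ofPred_eq, objJ] at this ⊢
    linarith
  have h3 : optJ β piRef rstar p - optJ β piRef r' p ≤ (ll r' - ll rstar) / κ := by
    rw [le_div_iff₀ hκ]; linarith
  have h4 : objJ β piRef p' r' p - objJ β piRef p' rstar p =
      ∑ a, ∑ b, p a * p' b * ((rstar a - rstar b) - (r' a - r' b)) := by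
    have e : ∀ f : A → ℝ, ∑ a, ∑ b, p a * p' b * (f b - f a) =
        ∑ b, p' b * f b - ∑ a, p a * f a := by
      intro f
      have e1 : ∀ a, ∑ b, p a * p' b * (f b - f a) = p a * (∑ b, p' b * f b) - p a * f a := by
        intro a
        calc ∑ b, p a * p' b * (f b - f a)
            = ∑ b, (p a * (p' b * f b) - p a * f a * p' b) :=
              Finset.sum_congr rfl fun b _ => by ring
          _ = _ := by
              rw [Finset.sum_sub_distrib, ← Finset.mul_sum, ← Finset.mul_sum, hp'.2, mul_one]
      rw [Finset.sum_congr rfl fun a _ => e1 a, Finset.sum_sub_distrib, ← Finset.sum_mul, hp.2,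
        one_mul]
    have e2 := e fun a => r' a - rstar a
    have e3 : ∑ a, ∑ b, p a * p' b * ((rstar a - rstar b) - (r' a - r' b)) =
        ∑ a, ∑ b, p a * p' b * ((r' b - rstar b) - (r' a - rstar a)) :=
      Finset.sum_congr rfl fun a _ => Finset.sum_congr rfl fun b _ => by ring
    rw [e3, e2]
    simp only [objJ, mul_sub, Finset.sum_sub_distrib]
    ring
  have h5 : ∑ a, ∑ b, p a * p' b * ((rstar a - rstar b) - (r' a - r' b)) ≤
      ∑ a, ∑ b, p a * p' b * |(r' a - r' b) - (rstar a - rstar b)| := by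
    refine Finset.sum_le_sum fun a _ => Finset.sum_le_sum fun b _ => ?_
    refine mul_le_mul_of_nonneg_left ?_ (mul_nonneg (hp.1 a) (hp'.1 b))
    rw [abs_sub_comm]
    exact le_abs_self _
  have h6 : objJ β piRef piStar rstar cal - objJ β piRef p' rstar cal =
      objJ β piRef piStar rstar p - objJ β piRef p' rstar p := by
    unfold objJ; ring
  linarith

end Policies

/-! ### Potential arguments for a single pair of actions -/

lemma min_add_sub_min {n w M c : ℝ} (hw : 0 ≤ w) (h : n + w ≤ M + c) :
    min (n + w) (M + c) - min n (M + c) = w := by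
  rw [min_eq_left h, min_eq_left (by linarith)]; ring

lemma min_sub_nonneg {n w c : ℝ} (hw : 0 ≤ w) : 0 ≤ min (n + w) c - min n c :=
  sub_nonneg.2 (min_le_min_right _ (by linarith))

lemma div_add_two_le_log {n w : ℝ} (hn : 0 ≤ n) (hw : 0 ≤ w) (hw2 : w ≤ 2) :
    w / (n + 2) ≤ 2 * (Real.log (n + w + 2) - Real.log (n + 2)) := by
  have h1 := Real.one_sub_inv_le_log_of_pos (x := (n + w + 2) / (n + 2)) (by positivity)
  rw [Real.log_div (by positivity) (by positivity)] at h1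
  have h2 : 1 - ((n + w + 2) / (n + 2))⁻¹ = w / (n + w + 2) := by
    rw [inv_div]; field_simp; ring
  rw [h2] at h1
  have h3 : w / (n + 2) ≤ 2 * (w / (n + w + 2)) := by
    rw [← mul_div_assoc, div_le_div_iff₀ (by positivity) (by positivity)]
    nlinarith
  linarith

/-- One round, when the exploration penalty is quadratic in the error `d ≤ 2 R`: `w` is the mass
of the pair in the round, `n` its mass in the past. The three parts of the potential pay for large
errors, for the first rounds, and for small errors. -/
lemma mul_sub_le_potential {n w d k R : ℝ} (hn : 0 ≤ n) (hw : 0 ≤ w) (hw2 : w ≤ 2)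
    (hd : 0 ≤ d) (hdR : d ≤ 2 * R) (hk : 0 < k) :
    w * d - k * n * min 1 (d ^ 2) ≤
      2 * R * (min (n + w) (4 * R / k + 2) - min n (4 * R / k + 2)) +
      (min (n + w) 4 - min n 4) +
      2 / k * (Real.log (n + w + 2) - Real.log (n + 2)) := by
  have hlog := div_add_two_le_log hn hw hw2
  have hlog0 : 0 ≤ w / (n + 2) := by positivity
  have t3 : 0 ≤ 2 / k * (Real.log (n + w + 2) - Real.log (n + 2)) := by
    apply mul_nonneg (by positivity); linarith
  have t2 : 0 ≤ min (n + w) 4 - min n 4 := min_sub_nonneg hw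
  have hR : 0 ≤ R := by linarith
  have t1 : 0 ≤ 2 * R * (min (n + w) (4 * R / k + 2) - min n (4 * R / k + 2)) :=
    mul_nonneg (by linarith) (min_sub_nonneg hw)
  rcases le_total 1 d with h1 | h1
  · rw [min_eq_left (show (1 : ℝ) ≤ d ^ 2 by nlinarith)]
    rcases le_total n (4 * R / k) with h2 | h2
    · rw [min_add_sub_min hw (by linarith)]
      have : 0 ≤ k * n * 1 := by positivity
      nlinarith
    · rw [div_le_iff₀ hk] at h2
      nlinarith
  · rw [min_eq_right (show d ^ 2 ≤ 1 by nlinarith)]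
    rcases le_total n 2 with h2 | h2
    · have e : min (n + w) 4 - min n 4 = w := by
        rw [min_eq_left (by linarith), min_eq_left (by linarith)]; ring
      rw [e]
      have : 0 ≤ k * n * d ^ 2 := by positivity
      nlinarith
    · have h3 : w * d - k * n * d ^ 2 ≤ 1 / k * (w / (n + 2)) := by
        have e : w * d - k * n * d ^ 2 ≤ w ^ 2 / (4 * k * n) := by
          rw [le_div_iff₀ (by positivity)]
          nlinarith [sq_nonneg (w - 2 * k * n * d)]
        refine e.trans ?_
        rw [div_mul_div_comm, one_mul, div_le_div_iff₀ (by positivity) (by positivity)]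
        have : 0 ≤ w * k := by positivity
        nlinarith [mul_nonneg this (sub_nonneg.2 h2),
          mul_nonneg (mul_nonneg this (show 0 ≤ n + 2 by linarith)) (sub_nonneg.2 hw2)]
      have h4 : 1 / k * (w / (n + 2)) ≤
          1 / k * (2 * (Real.log (n + w + 2) - Real.log (n + 2))) := by gcongr
      have h5 : 1 / k * (2 * (Real.log (n + w + 2) - Real.log (n + 2))) =
        2 / k * (Real.log (n + w + 2) - Real.log (n + 2)) := by ring
      linarith

lemma sum_sub_eq {f : ℕ → ℝ} {a b : ℕ} (h : a ≤ b) :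
    ∑ t ∈ Finset.Ico a b, (f (t + 1) - f t) = f b - f a :=
  Finset.sum_Ico_sub f h

section Pair

variable {T : ℕ} {W N y : ℕ → ℝ} {x R κ : ℝ}

/-- A pair with true gap `x`, whose masses `W` and estimated gaps `y` are known only through their
ranges. -/
lemma sum_pair_le_exp (hT : 2 ≤ T) (hW : ∀ t, 0 ≤ W t) (hW2 : ∀ t, W t ≤ 2)
    (hNT : N T ≤ 2 * T)
    (hN : ∀ t ∈ Finset.Ico 1 T, N (t + 1) = N t + W (t + 1)) (hNn : ∀ t, 0 ≤ N t)
    (hx : 0 ≤ x) (hd : ∀ t ∈ Finset.Ico 1 T, |y (t + 1) - x| ≤ 2 * R) (hR : 0 ≤ R) (hκ : 0 < κ) :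
    ∑ t ∈ Finset.Ico 1 T, (W (t + 1) * |y (t + 1) - x| - N t * hellinger x (y (t + 1)) / κ) ≤
      576 * R ^ 2 * κ * Real.exp x + 4 * R + 4 + 288 * κ * Real.exp x * Real.log T := by
  have hN1 := hNn 1
  set k := Real.exp (-x) / (72 * κ) with hkdef
  have hk : 0 < k := by positivity
  set Φ : ℕ → ℝ := fun t => 2 * R * min (N t) (4 * R / k + 2) + min (N t) 4 +
    2 / k * Real.log (N t + 2) with hΦ
  have step : ∀ t ∈ Finset.Ico 1 T,
      W (t + 1) * |y (t + 1) - x| - N t * hellinger x (y (t + 1)) / κ ≤ Φ (t + 1) - Φ t := by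
    intro t ht
    have h1 := mul_sub_le_potential (hNn t) (hW (t + 1)) (hW2 (t + 1)) (abs_nonneg _) (hd t ht) hk
    rw [← hN t ht] at h1
    have h2 := exp_neg_mul_min_le_hellinger hx (y (t + 1))
    have h3 : k * N t * min 1 (|y (t + 1) - x| ^ 2) ≤ N t * hellinger x (y (t + 1)) / κ := by
      rw [le_div_iff₀ hκ, hkdef]
      calc _ = N t * (Real.exp (-x) * min 1 (|y (t + 1) - x| ^ 2) / 72) := by field_simp
        _ ≤ _ := mul_le_mul_of_nonneg_left h2 (hNn t)
    simp only [hΦ]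
    linarith
  refine (Finset.sum_le_sum step).trans ?_
  rw [sum_sub_eq (by omega)]
  have hT2 : (2 : ℝ) ≤ T := by exact_mod_cast hT
  have l1 : Real.log (N T + 2) ≤ Real.log (2 * T + 2) :=
    Real.log_le_log (by linarith [hNn T]) (by linarith)
  have l2 : Real.log 2 ≤ Real.log (N 1 + 2) := Real.log_le_log (by norm_num) (by linarith)
  have l3 : Real.log (2 * T + 2) ≤ Real.log 2 + 2 * Real.log T := by
    have : Real.log 2 + 2 * Real.log T = Real.log (2 * T ^ 2) := by
      rw [Real.log_mul (by norm_num) (by positivity), Real.log_pow]; norm_num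
    rw [this]
    exact Real.log_le_log (by positivity) (by nlinarith)
  have m0 : 0 ≤ 4 * R / k + 2 := by positivity
  have b1 : 2 * R * min (N T) (4 * R / k + 2) ≤ 2 * R * (4 * R / k + 2) :=
    mul_le_mul_of_nonneg_left (min_le_right _ _) (by linarith)
  have b2 : 0 ≤ 2 * R * min (N 1) (4 * R / k + 2) := by positivity
  have b3 : min (N T) 4 ≤ 4 := min_le_right _ _
  have b4 : 0 ≤ min (N 1) 4 := by positivity
  have b5 : 2 / k * (Real.log (N T + 2) - Real.log (N 1 + 2)) ≤ 2 / k * (2 * Real.log T) :=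
    mul_le_mul_of_nonneg_left (by linarith) (by positivity)
  have hk' : 1 / k = 72 * κ * Real.exp x := by
    rw [hkdef, Real.exp_neg]; field_simp
  have e1 : 2 * R * (4 * R / k + 2) = 8 * R ^ 2 * (1 / k) + 4 * R := by ring
  have e2 : 2 / k * (2 * Real.log T) = 4 * (1 / k) * Real.log T := by ring
  rw [e1, hk'] at b1
  rw [e2, hk'] at b5
  simp only [hΦ]
  linarith

/-- A pair whose true gap `x` exceeds `Y + 1`. Rounds in which both policies come from estimated
gaps at least `Y` have small mass `ε`. Every other round involves an estimate that is wrong by more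
than `1`, and is paid for by the penalty of the round that made this estimate; a penalty can be
called on twice, hence the halves. -/
lemma sum_pair_le_threshold {Y ε : ℝ} (hT : 2 ≤ T) (hW : ∀ t, 0 ≤ W t) (hW2 : ∀ t, W t ≤ 2)
    (hN : ∀ t ∈ Finset.Ico 1 T, N (t + 1) = N t + W (t + 1)) (hNn : ∀ t, 0 ≤ N t)
    (hx : 0 ≤ x) (hd : ∀ t ∈ Finset.Ico 1 T, |y (t + 1) - x| ≤ 2 * R) (hR : 0 ≤ R) (hκ : 0 < κ)
    (hY : Y + 1 ≤ x) (hε : 0 ≤ ε)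
    (hWε : ∀ t ∈ Finset.Ico 2 T, Y ≤ y t → Y ≤ y (t + 1) → W (t + 1) ≤ ε) :
    ∑ t ∈ Finset.Ico 1 T, (W (t + 1) * |y (t + 1) - x| - N t * hellinger x (y (t + 1)) / κ) ≤
      2 * R * T * ε + 1152 * R ^ 2 * κ * (1 + Real.exp Y) + 12 * R := by
  set k := min 1 (Real.exp (-Y)) / (144 * κ) with hkdef
  have hmin : 0 < min 1 (Real.exp (-Y)) := lt_min one_pos (Real.exp_pos _)
  have hk : 0 < k := by positivity
  have hk' : 1 / k ≤ 144 * κ * (1 + Real.exp Y) := by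
    have : 1 / min 1 (Real.exp (-Y)) ≤ 1 + Real.exp Y := by
      rw [div_le_iff₀ hmin]
      rcases min_choice 1 (Real.exp (-Y)) with h | h <;> rw [h]
      · linarith [Real.exp_pos Y]
      · have : Real.exp Y * Real.exp (-Y) = 1 := by rw [← Real.exp_add]; simp
        nlinarith [Real.exp_pos (-Y)]
    calc 1 / k = 144 * κ * (1 / min 1 (Real.exp (-Y))) := by rw [hkdef]; field_simp
      _ ≤ _ := by gcongr
  set P : ℕ → ℝ := fun t => N t * hellinger x (y (t + 1)) / (2 * κ) with hP
  have hP0 : ∀ t, 0 ≤ P t := fun t =>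
    div_nonneg (mul_nonneg (hNn t) (hellinger_nonneg _ _)) (by linarith)
  have hPk : ∀ t, y (t + 1) ≤ Y → k * N t ≤ P t := by
    intro t h
    have := mul_le_mul_of_nonneg_left (min_exp_neg_le_hellinger hx h hY) (hNn t)
    simp only [hP]
    rw [le_div_iff₀ (by positivity), hkdef]
    calc _ = N t * (min 1 (Real.exp (-Y)) / 72) := by field_simp; ring
      _ ≤ _ := this
  set M := 4 * R / k with hM
  have hM0 : 0 ≤ M := by positivity
  set g : ℕ → ℝ := fun t => 2 * R * min (N t) (M + 4) with hg
  have hgm : ∀ t ∈ Finset.Ico 1 T, 0 ≤ g (t + 1) - g t := by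
    intro t ht
    simp only [hg]
    rw [← mul_sub, hN t ht]
    exact mul_nonneg (by linarith) (min_sub_nonneg (hW _))
  have hWd : ∀ t ∈ Finset.Ico 1 T, W (t + 1) * |y (t + 1) - x| ≤ W (t + 1) * (2 * R) :=
    fun t ht => mul_le_mul_of_nonneg_left (hd t ht) (hW _)
  -- A penalty proportional to a past count `N s`, at most two rounds old, pays for a round.
  have pay : ∀ t ∈ Finset.Ico 1 T, ∀ s, N t ≤ N s + 2 →
      W (t + 1) * (2 * R) - k * N s ≤ g (t + 1) - g t := by
    intro t ht s hs
    rcases le_total (N s) M with h | h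
    · simp only [hg]
      rw [← mul_sub, hN t ht, min_add_sub_min (hW _) (by linarith [hW2 (t + 1)])]
      have := mul_nonneg hk.le (hNn s)
      linarith
    · have := hgm t ht
      rw [hM, div_le_iff₀ hk] at h
      nlinarith [hW2 (t + 1)]
  have step : ∀ t ∈ Finset.Ico 2 T,
      W (t + 1) * |y (t + 1) - x| - P t - P (t - 1) ≤ 2 * R * ε + (g (t + 1) - g t) := by
    intro t ht
    rw [Finset.mem_Ico] at ht
    have ht1 : t ∈ Finset.Ico 1 T := Finset.mem_Ico.2 ⟨by omega, ht.2⟩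
    have e : t - 1 + 1 = t := by omega
    have ht2 : t - 1 ∈ Finset.Ico 1 T := Finset.mem_Ico.2 ⟨by omega, by omega⟩
    have h0 := mul_nonneg hR hε
    have a1 := hWd t ht1
    have a2 := hP0 t
    have a3 := hP0 (t - 1)
    rcases le_total (y (t + 1)) Y with h | h
    · have := pay t ht1 t (by linarith)
      have := hPk t h
      linarith
    rcases le_total (y t) Y with h' | h'
    · have hn := hN (t - 1) ht2
      rw [e] at hn
      have := pay t ht1 (t - 1) (by linarith [hW2 t])
      have := hPk (t - 1) (by rwa [e])
      linarith
    · have := hWε t (Finset.mem_Ico.2 ht) h' h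
      have := hgm t ht1
      nlinarith
  have split : ∀ f : ℕ → ℝ, ∑ t ∈ Finset.Ico 1 T, f t = f 1 + ∑ t ∈ Finset.Ico 2 T, f t :=
    fun f => Finset.sum_eq_sum_Ico_succ_bot (by omega) f
  have shift : ∑ t ∈ Finset.Ico 2 T, P (t - 1) ≤ ∑ t ∈ Finset.Ico 1 T, P t := by
    have h1 : ∑ t ∈ Finset.Ico 2 T, P (t - 1) = ∑ t ∈ Finset.Ico 1 (T - 1), P t := by
      have := Finset.sum_Ico_add' (fun t => P (t - 1)) 1 (T - 1) 1
      rw [show T - 1 + 1 = T by omega] at this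
      rw [← this]
      rfl
    rw [h1]
    exact Finset.sum_le_sum_of_subset_of_nonneg
      (Finset.Ico_subset_Ico_right (by omega)) fun t _ _ => hP0 t
  have main := Finset.sum_le_sum step
  rw [Finset.sum_add_distrib, sum_sub_eq hT, Finset.sum_sub_distrib, Finset.sum_sub_distrib,
    Finset.sum_const, Nat.card_Ico, nsmul_eq_mul] at main
  have first : W 2 * |y 2 - x| ≤ 4 * R := by
    have h1 := hWd 1 (Finset.mem_Ico.2 ⟨le_rfl, by omega⟩)
    have := hW2 2
    norm_num at h1
    nlinarith
  have e : ∑ t ∈ Finset.Ico 1 T,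
      (W (t + 1) * |y (t + 1) - x| - N t * hellinger x (y (t + 1)) / κ) =
      ∑ t ∈ Finset.Ico 1 T, W (t + 1) * |y (t + 1) - x| - 2 * ∑ t ∈ Finset.Ico 1 T, P t := by
    rw [Finset.mul_sum, ← Finset.sum_sub_distrib]
    refine Finset.sum_congr rfl fun t _ => ?_
    simp only [hP]
    field_simp
  have hsP := split P
  have hsW := split fun t => W (t + 1) * |y (t + 1) - x|
  have hP1 := hP0 1
  have hcard : ((T - 2 : ℕ) : ℝ) * (2 * R * ε) ≤ T * (2 * R * ε) := by
    apply mul_le_mul_of_nonneg_right _ (by positivity)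
    exact_mod_cast Nat.sub_le T 2
  have hgT : g T - g 2 ≤ 8 * R ^ 2 * (1 / k) + 8 * R := by
    have h1 : g T ≤ 2 * R * (M + 4) :=
      mul_le_mul_of_nonneg_left (min_le_right _ _) (by linarith)
    have h2 : 0 ≤ g 2 := mul_nonneg (by linarith) (le_min (hNn 2) (by linarith))
    have h3 : 2 * R * (M + 4) = 8 * R ^ 2 * (1 / k) + 8 * R := by rw [hM]; ring
    linarith
  have hfin : 8 * R ^ 2 * (1 / k) ≤ 8 * R ^ 2 * (144 * κ * (1 + Real.exp Y)) := by gcongr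
  rw [e, hsW]
  norm_num at hsW first ⊢
  linarith

end Pair

/-- The two bounds for a pair combined. The threshold `Y` balances the mass `T ρ exp (-Y / β)` of
the rounds with estimated gap at least `Y` against the cost `κ R exp Y` of the other rounds. -/
lemma sum_pair_le_min {T : ℕ} {W N y : ℕ → ℝ} {x R κ ρ β r₀ : ℝ}
    (hT : 2 ≤ T) (hW : ∀ t, 0 ≤ W t) (hW2 : ∀ t, W t ≤ 2)
    (hNT : N T ≤ 2 * T)
    (hN : ∀ t ∈ Finset.Ico 1 T, N (t + 1) = N t + W (t + 1)) (hNn : ∀ t, 0 ≤ N t)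
    (hx : 0 ≤ x) (hd : ∀ t ∈ Finset.Ico 1 T, |y (t + 1) - x| ≤ 2 * R) (hr₀ : 0 < r₀)
    (hR : r₀ ≤ R) (hκ : 0 < κ) (hρ : 0 < ρ) (hβ : 0 < β)
    (hWρ : ∀ t ∈ Finset.Ico 2 T,
      W (t + 1) ≤ ρ * Real.exp (-(y (t + 1) / β)) + ρ * Real.exp (-(y t / β))) :
    ∑ t ∈ Finset.Ico 1 T, (W (t + 1) * |y (t + 1) - x| - N t * hellinger x (y (t + 1)) / κ) ≤
      2000 * (1 + 1 / r₀) * ((R + Real.log T) * min (Real.exp x * κ * R)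
        ((T * ρ) ^ (β / (β + 1)) * κ ^ (1 / (β + 1)) * R ^ (1 / (β + 1))) + κ * R ^ 2 + R) := by
  have hR0 : 0 < R := hr₀.trans_le hR
  have hT0 : (0 : ℝ) < T := by exact_mod_cast (by omega : 0 < T)
  have hlogT : 0 ≤ Real.log T := Real.log_natCast_nonneg T
  set E := (T * ρ) ^ (β / (β + 1)) * κ ^ (1 / (β + 1)) * R ^ (1 / (β + 1)) with hE
  have hE0 : 0 < E := by positivity
  set Y := Real.log (E / (κ * R)) with hY
  have hEY : E = Real.exp Y * κ * R := by
    rw [hY, Real.exp_log (by positivity)]; field_simp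
  have hlogE : Real.log E = β / (β + 1) * Real.log (T * ρ) + 1 / (β + 1) * Real.log (κ * R) := by
    rw [hE, Real.log_mul (by positivity) (by positivity),
      Real.log_mul (by positivity) (by positivity), Real.log_rpow (by positivity),
      Real.log_rpow hκ, Real.log_rpow hR0, Real.log_mul hκ.ne' hR0.ne']
    ring
  have hbal : T * (ρ * Real.exp (-(Y / β))) = E := by
    have h1 : Real.log (T * (ρ * Real.exp (-(Y / β)))) = Real.log E := by
      rw [← mul_assoc, Real.log_mul (by positivity) (by positivity), Real.log_exp, hY,
        Real.log_div hE0.ne' (by positivity), hlogE]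
      field_simp
      ring
    exact Real.log_injOn_pos (Set.mem_Ioi.2 (by positivity)) (Set.mem_Ioi.2 hE0) h1
  have hc : 0 < 1 / r₀ := by positivity
  rcases le_total (Y + 1) x with h | h
  · have hmin : min (Real.exp x * κ * R) E = E := by
      apply min_eq_right
      rw [hEY]
      gcongr
      linarith
    rw [hmin]
    have h1 := sum_pair_le_threshold (ε := 2 * (ρ * Real.exp (-(Y / β)))) hT hW hW2 hN hNn hx hd
      hR0.le hκ h (by positivity) (by
        intro t ht ha hb
        have e : ∀ z, Y ≤ z → ρ * Real.exp (-(z / β)) ≤ ρ * Real.exp (-(Y / β)) := by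
          intro z hz; gcongr
        have := e _ ha
        have := e _ hb
        have := hWρ t ht
        linarith)
    refine h1.trans ?_
    have e1 : 2 * R * T * (2 * (ρ * Real.exp (-(Y / β)))) = 4 * R * E := by
      rw [← hbal]; ring
    have e2 : 1152 * R ^ 2 * κ * (1 + Real.exp Y) = 1152 * (κ * R ^ 2) + 1152 * R * E := by
      rw [hEY]; ring
    rw [e1, e2]
    have i1 : 0 ≤ (R + Real.log T) * E + κ * R ^ 2 + R := by positivity
    have i2 : 0 ≤ Real.log T * E := by positivity
    have i3 : 0 ≤ κ * R ^ 2 := by positivity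
    have i4 : 0 ≤ R * E := by positivity
    have i5 := mul_nonneg hc.le i1
    nlinarith
  · have h1 := sum_pair_le_exp hT hW hW2 hNT hN hNn hx hd hR0.le hκ
    refine h1.trans ?_
    set F := Real.exp x * κ * R with hF
    have hF0 : 0 < F := by positivity
    have hmin : F ≤ 3 * min F E := by
      rcases min_choice F E with h' | h' <;> rw [h']
      · linarith
      · have : Real.exp x ≤ 3 * Real.exp Y := by
          calc Real.exp x ≤ Real.exp (Y + 1) := Real.exp_le_exp.2 h
            _ = Real.exp 1 * Real.exp Y := by rw [Real.exp_add]; ring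
            _ ≤ _ := by gcongr; exact Real.exp_one_lt_three.le
        rw [hEY, hF]
        calc Real.exp x * κ * R ≤ (3 * Real.exp Y) * κ * R := by gcongr
          _ = _ := by ring
    set m := min F E with hm
    have hm0 : 0 < m := lt_min hF0 hE0
    have e1 : 576 * R ^ 2 * κ * Real.exp x = 576 * (R * F) := by rw [hF]; ring
    have e2 : 288 * κ * Real.exp x * Real.log T = 288 * (1 / R) * (F * Real.log T) := by
      rw [hF]; field_simp
    rw [e1, e2]
    have i0 : 1 / R ≤ 1 / r₀ := one_div_le_one_div_of_le hr₀ hR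
    have i1 : R * F ≤ 3 * (R * m) := by nlinarith
    have i2 : F * Real.log T ≤ 3 * (m * Real.log T) := by nlinarith
    have i3 : 288 * (1 / R) * (F * Real.log T) ≤ 288 * (1 / r₀) * (3 * (m * Real.log T)) := by
      gcongr
    have i4 : (4 : ℝ) ≤ 4 * ((1 / r₀) * R) := by
      have : 1 ≤ 1 / r₀ * R := by rw [one_div_mul_eq_div, one_le_div hr₀]; exact hR
      linarith
    have i5 : 0 ≤ κ * R ^ 2 := by positivity
    have i6 : 0 ≤ m * Real.log T := by positivity
    have i7 : 0 ≤ R * m := by positivity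
    have i8 := mul_nonneg hc.le i5
    have i9 := mul_nonneg hc.le i6
    have i10 := mul_nonneg hc.le i7
    have i11 : 0 ≤ 1 / r₀ * R := by positivity
    nlinarith

/-! ### From the confidence bound to the regret bound -/

section Regret

variable {A : Type*}

/-- The probability, summed over the rounds `1, …, t`, of sampling `a` first and `b` second. -/
noncomputable def pairMass (π : ℕ → A → ℝ) (t : ℕ) (a b : A) : ℝ :=
  ∑ i ∈ Finset.Icc 1 t, π (i - 1) a * π i b

lemma pairMass_succ (π : ℕ → A → ℝ) (t : ℕ) (a b : A) :
    pairMass π (t + 1) a b = pairMass π t a b + π t a * π (t + 1) b := by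
  unfold pairMass
  rw [Finset.sum_Icc_succ_top (by omega)]
  rfl

lemma abs_sub_le_of_mem {r : A → ℝ} {R : ℝ} (hr : r ∈ rewardClass A R) (a b : A) :
    |r a - r b| ≤ R := by
  have h1 := hr a
  have h2 := hr b
  rw [abs_le]; constructor <;> linarith

variable [Fintype A]

lemma sum_pairs_swap (f : A → A → ℝ) (s : A → ℝ) :
    ∑ p : A × A with s p.2 ≤ s p.1, (f p.1 p.2 + f p.2 p.1) =
      ∑ a, ∑ b, ((if s b ≤ s a then f a b else 0) + (if s a ≤ s b then f a b else 0)) := by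
  rw [Finset.sum_filter]
  have h : ∀ p : A × A, (if s p.2 ≤ s p.1 then f p.1 p.2 + f p.2 p.1 else 0) =
      (if s p.2 ≤ s p.1 then f p.1 p.2 else 0) + (if s p.2 ≤ s p.1 then f p.2 p.1 else 0) := by
    intro p; split_ifs <;> simp
  simp_rw [h]
  rw [Finset.sum_add_distrib, Fintype.sum_prod_type, Fintype.sum_prod_type]
  simp_rw [Finset.sum_add_distrib]
  congr 1
  exact Finset.sum_comm

lemma sum_le_sum_pairs {f : A → A → ℝ} (hf : ∀ a b, 0 ≤ f a b) (s : A → ℝ) :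
    ∑ a, ∑ b, f a b ≤ ∑ p : A × A with s p.2 ≤ s p.1, (f p.1 p.2 + f p.2 p.1) := by
  rw [sum_pairs_swap]
  refine Finset.sum_le_sum fun a _ => Finset.sum_le_sum fun b _ => ?_
  have := hf a b
  rcases le_total (s b) (s a) with h | h <;> rw [if_pos h] <;> split_ifs <;> linarith

/-- Pairs with equal reward are counted in both orders, hence the factor `2`. -/
lemma sum_pairs_le_two_mul {f : A → A → ℝ} (hf : ∀ a b, 0 ≤ f a b) (s : A → ℝ) :
    ∑ p : A × A with s p.2 ≤ s p.1, (f p.1 p.2 + f p.2 p.1) ≤ 2 * ∑ a, ∑ b, f a b := by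
  rw [sum_pairs_swap, Finset.mul_sum]
  refine Finset.sum_le_sum fun a _ => ?_
  rw [Finset.mul_sum]
  refine Finset.sum_le_sum fun b _ => ?_
  have := hf a b
  split_ifs <;> linarith

lemma le_one_of_mem {p : A → ℝ} (hp : p ∈ stdSimplex ℝ A) (a : A) : p a ≤ 1 := by
  rw [← hp.2]
  exact Finset.single_le_sum (fun i _ => hp.1 i) (Finset.mem_univ a)

lemma pairMass_nonneg {π : ℕ → A → ℝ} (hπ : ∀ t, π t ∈ stdSimplex ℝ A) (t : ℕ) (a b : A) :
    0 ≤ pairMass π t a b :=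
  Finset.sum_nonneg fun _ _ => mul_nonneg ((hπ _).1 a) ((hπ _).1 b)

lemma pairMass_le {π : ℕ → A → ℝ} (hπ : ∀ t, π t ∈ stdSimplex ℝ A) (t : ℕ) (a b : A) :
    pairMass π t a b ≤ t := by
  calc pairMass π t a b ≤ ∑ i ∈ Finset.Icc 1 t, (1 : ℝ) :=
        Finset.sum_le_sum fun _ _ =>
          mul_le_one₀ (le_one_of_mem (hπ _) a) ((hπ _).1 b) (le_one_of_mem (hπ _) b)
    _ = t := by simp

/-- The cumulated Hellinger distance between the comparison laws of `rstar` and of `r`. -/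
noncomputable def infoGain (rstar : A → ℝ) (π : ℕ → A → ℝ) (t : ℕ) (r : A → ℝ) : ℝ :=
  ∑ a, ∑ b, pairMass π t a b * hellinger (rstar a - rstar b) (r a - r b)

/-- The bound on the exploration of a pair `(a₊, a₋)`: the first entry is the cost of learning the
true gap from comparisons, the second one that of learning that the gap is large enough for the
policies to avoid `a₋`. The parameter `κ` is the last exploration coefficient `α T`. -/
noncomputable def pairCost (T : ℕ) (β R κ : ℝ) (rstar piRef : A → ℝ) (p : A × A) : ℝ :=
  min (humanPolicy rstar p.1 / humanPolicy rstar p.2 * κ * R)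
    ((T * (piRef p.2 / piRef p.1)) ^ (β / (β + 1)) * κ ^ (1 / (β + 1)) * R ^ (1 / (β + 1)))

lemma humanPolicy_div (rstar : A → ℝ) (a b : A) :
    humanPolicy rstar a / humanPolicy rstar b = Real.exp (rstar a - rstar b) := by
  have hZ : 0 < ∑ b, Real.exp (rstar b) :=
    Finset.sum_pos (fun b _ => Real.exp_pos _) ⟨a, Finset.mem_univ a⟩
  unfold humanPolicy
  rw [Real.exp_sub]
  field_simp

/-- On the event that the excess log-likelihood of every estimate is bounded by `B` minus twice its
information gain, the regret is bounded. -/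
theorem regret_le_of_confidence [Nonempty A] {T : ℕ} {β R r₀ B : ℝ} {α : ℕ → ℝ}
    {rstar piRef piStar cal : A → ℝ} {D : ℕ → Sample A} {r π : ℕ → A → ℝ}
    (hT : 2 ≤ T) (hβ : 0 < β) (hr₀ : 0 < r₀) (hR : r₀ ≤ R)
    (hα0 : ∀ t, 1 ≤ t → t ≤ T → 0 < α t) (hα : ∀ t, 1 ≤ t → t ≤ T → α t ≤ α T)
    (hrstar : rstar ∈ rewardClass A R)
    (hRef : piRef ∈ stdSimplex ℝ A) (hRef0 : ∀ a, 0 < piRef a)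
    (hs : piStar ∈ stdSimplex ℝ A)
    (hstar : IsMaxOn (fun p => objJ β piRef p rstar cal) (stdSimplex ℝ A) piStar)
    (hπ : ∀ t, π t ∈ stdSimplex ℝ A) (hkl : β * kl (π 1) piRef ≤ R)
    (hr : ∀ t ∈ Finset.Ico 1 T, r (t + 1) ∈ rewardClass A R)
    (hrmax : ∀ t ∈ Finset.Ico 1 T, logLik D t rstar + α t * optJ β piRef rstar (π t) ≤
      logLik D t (r (t + 1)) + α t * optJ β piRef (r (t + 1)) (π t))
    (hπmax : ∀ t ∈ Finset.Ico 1 T,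
      IsMaxOn (fun p => objJ β piRef p (r (t + 1)) (π t)) (stdSimplex ℝ A) (π (t + 1)))
    (hconf : ∀ t ∈ Finset.Ico 1 T, logLik D t (r (t + 1)) - logLik D t rstar
      + 2 * infoGain rstar π t (r (t + 1)) ≤ B) :
    regret T β piRef rstar cal piStar π ≤ 2 * R + ∑ t ∈ Finset.Ico 1 T, B / α t +
      2000 * (1 + 1 / r₀) * ∑ p : A × A with rstar p.2 ≤ rstar p.1,
        ((R + Real.log T) * pairCost T β R (α T) rstar piRef p + α T * R ^ 2 + R) := by
  have hαT : 0 < α T := hα0 T (by omega) le_rfl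
  set d : ℕ → A → A → ℝ := fun t a b => |(r t a - r t b) - (rstar a - rstar b)| with hd
  set h : ℕ → A → A → ℝ := fun t a b => hellinger (rstar a - rstar b) (r t a - r t b) with hh
  have hd_comm : ∀ t a b, d t b a = d t a b := by
    intro t a b
    simp only [hd]
    rw [← abs_neg]; congr 1; ring
  have hh_comm : ∀ t a b, h t b a = h t a b := by
    intro t a b
    simp only [hh]
    rw [← hellinger_neg]; congr 1 <;> ring
  have hh0 : ∀ t a b, 0 ≤ h t a b := fun t a b => hellinger_nonneg _ _
  have round : ∀ t ∈ Finset.Ico 1 T,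
      objJ β piRef piStar rstar cal - objJ β piRef (π (t + 1)) rstar cal ≤ B / α t +
      ∑ p : A × A with rstar p.2 ≤ rstar p.1,
        ((π t p.1 * π (t + 1) p.2 + π t p.2 * π (t + 1) p.1) * d (t + 1) p.1 p.2 -
          (pairMass π t p.1 p.2 + pairMass π t p.2 p.1) * h (t + 1) p.1 p.2 / α T) := by
    intro t ht
    have ht' := Finset.mem_Ico.1 ht
    have hαt : 0 < α t := hα0 t ht'.1 ht'.2.le
    have h1 := objJ_sub_le_of_optimistic (hπ t) (hπ (t + 1)) hs hstar (hπmax t ht) hαt (hrmax t ht)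
    have h2 : (logLik D t (r (t + 1)) - logLik D t rstar) / α t ≤
        B / α t - 2 * infoGain rstar π t (r (t + 1)) / α T := by
      have hI : 0 ≤ infoGain rstar π t (r (t + 1)) :=
        Finset.sum_nonneg fun a _ => Finset.sum_nonneg fun b _ =>
          mul_nonneg (pairMass_nonneg hπ t a b) (hellinger_nonneg _ _)
      have h3 : 2 * infoGain rstar π t (r (t + 1)) / α T ≤
          2 * infoGain rstar π t (r (t + 1)) / α t := by
        have := hα t ht'.1 ht'.2.le
        gcongr
      have h4 : (logLik D t (r (t + 1)) - logLik D t rstar) / α t ≤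
          (B - 2 * infoGain rstar π t (r (t + 1))) / α t := by
        have := hconf t ht
        exact div_le_div_of_nonneg_right (by linarith) hαt.le
      rw [sub_div B] at h4
      linarith
    have h3 := sum_le_sum_pairs (f := fun a b => π t a * π (t + 1) b * d (t + 1) a b)
      (fun a b => mul_nonneg (mul_nonneg ((hπ _).1 a) ((hπ _).1 b)) (abs_nonneg _)) rstar
    have h4 := sum_pairs_le_two_mul (f := fun a b => pairMass π t a b * h (t + 1) a b)
      (fun a b => mul_nonneg (pairMass_nonneg hπ t a b) (hh0 _ _ _)) rstar
    have h5 : ∑ p : A × A with rstar p.2 ≤ rstar p.1,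
        ((π t p.1 * π (t + 1) p.2 + π t p.2 * π (t + 1) p.1) * d (t + 1) p.1 p.2 -
          (pairMass π t p.1 p.2 + pairMass π t p.2 p.1) * h (t + 1) p.1 p.2 / α T) =
        ∑ p : A × A with rstar p.2 ≤ rstar p.1,
          (π t p.1 * π (t + 1) p.2 * d (t + 1) p.1 p.2 +
            π t p.2 * π (t + 1) p.1 * d (t + 1) p.2 p.1) -
        (∑ p : A × A with rstar p.2 ≤ rstar p.1,
          (pairMass π t p.1 p.2 * h (t + 1) p.1 p.2 +
            pairMass π t p.2 p.1 * h (t + 1) p.2 p.1)) / α T := by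
      rw [Finset.sum_div, ← Finset.sum_sub_distrib]
      refine Finset.sum_congr rfl fun p _ => ?_
      rw [hd_comm _ p.1 p.2, hh_comm _ p.1 p.2]
      ring
    have h6 : (∑ p : A × A with rstar p.2 ≤ rstar p.1,
          (pairMass π t p.1 p.2 * h (t + 1) p.1 p.2 +
            pairMass π t p.2 p.1 * h (t + 1) p.2 p.1)) / α T ≤
        2 * infoGain rstar π t (r (t + 1)) / α T := by
      gcongr
      exact h4
    rw [h5]
    linarith
  have pair : ∀ p ∈ (Finset.univ.filter fun p : A × A => rstar p.2 ≤ rstar p.1),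
      ∑ t ∈ Finset.Ico 1 T,
        ((π t p.1 * π (t + 1) p.2 + π t p.2 * π (t + 1) p.1) * d (t + 1) p.1 p.2 -
          (pairMass π t p.1 p.2 + pairMass π t p.2 p.1) * h (t + 1) p.1 p.2 / α T) ≤
      2000 * (1 + 1 / r₀) *
        ((R + Real.log T) * pairCost T β R (α T) rstar piRef p + α T * R ^ 2 + R) := by
    intro p hp
    have hp' : rstar p.2 ≤ rstar p.1 := (Finset.mem_filter.1 hp).2
    have hcost := humanPolicy_div rstar p.1 p.2
    have key := sum_pair_le_min (T := T)
      (W := fun t => π (t - 1) p.1 * π t p.2 + π (t - 1) p.2 * π t p.1)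
      (N := fun t => pairMass π t p.1 p.2 + pairMass π t p.2 p.1)
      (y := fun t => r t p.1 - r t p.2) (x := rstar p.1 - rstar p.2) (R := R) (κ := α T)
      (ρ := piRef p.2 / piRef p.1) (β := β) (r₀ := r₀) hT
      (fun t => add_nonneg (mul_nonneg ((hπ _).1 _) ((hπ _).1 _))
        (mul_nonneg ((hπ _).1 _) ((hπ _).1 _)))
      (fun t => by
        have h1 := mul_le_one₀ (le_one_of_mem (hπ (t - 1)) p.1) ((hπ t).1 p.2)
          (le_one_of_mem (hπ t) p.2)
        have h2 := mul_le_one₀ (le_one_of_mem (hπ (t - 1)) p.2) ((hπ t).1 p.1)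
          (le_one_of_mem (hπ t) p.1)
        linarith)
      (by linarith [pairMass_le hπ T p.1 p.2, pairMass_le hπ T p.2 p.1])
      (fun t _ => by
        simp only [pairMass_succ, Nat.add_sub_cancel]; ring)
      (fun t => add_nonneg (pairMass_nonneg hπ _ _ _) (pairMass_nonneg hπ _ _ _))
      (sub_nonneg.2 hp')
      (fun t ht => by
        have h1 := abs_sub_le_of_mem (hr t ht) p.1 p.2
        have h2 := abs_sub_le_of_mem hrstar p.1 p.2
        have := abs_sub (r (t + 1) p.1 - r (t + 1) p.2) (rstar p.1 - rstar p.2)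
        linarith)
      hr₀ hR hαT (div_pos (hRef0 _) (hRef0 _)) hβ
      (fun t ht => by
        have ht' := Finset.mem_Ico.1 ht
        have h1 := le_ratio_mul_exp_of_isMaxOn hβ hRef0 (hπ (t + 1))
          (hπmax t (Finset.mem_Ico.2 ⟨by omega, ht'.2⟩)) p.1 p.2
        have h2 := hπmax (t - 1) (Finset.mem_Ico.2 ⟨by omega, by omega⟩)
        rw [show t - 1 + 1 = t by omega] at h2
        have h3 := le_ratio_mul_exp_of_isMaxOn hβ hRef0 (hπ t) h2 p.1 p.2
        have h4 := mul_le_of_le_one_left ((hπ (t + 1)).1 p.2) (le_one_of_mem (hπ t) p.1)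
        have h5 := mul_le_of_le_one_right ((hπ t).1 p.2) (le_one_of_mem (hπ (t + 1)) p.1)
        simp only [Nat.add_sub_cancel]
        linarith)
    unfold pairCost
    rw [hcost]
    exact key
  have first : objJ β piRef piStar rstar cal - objJ β piRef (π 1) rstar cal ≤ 2 * R :=
    objJ_sub_le hβ hRef hRef0 (hπ 1) hs hrstar hkl
  have hsplit : regret T β piRef rstar cal piStar π =
      (objJ β piRef piStar rstar cal - objJ β piRef (π 1) rstar cal) + ∑ t ∈ Finset.Ico 1 T,
        (objJ β piRef piStar rstar cal - objJ β piRef (π (t + 1)) rstar cal) := by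
    unfold regret
    rw [← Finset.Ico_add_one_right_eq_Icc, Finset.sum_eq_sum_Ico_succ_bot (by omega)]
    congr 1
    exact (Finset.sum_Ico_add' (fun t => objJ β piRef piStar rstar cal -
      objJ β piRef (π t) rstar cal) 1 T 1).symm
  have hsum := Finset.sum_le_sum round
  rw [Finset.sum_add_distrib, Finset.sum_comm] at hsum
  have hpairs := Finset.sum_le_sum pair
  rw [← Finset.mul_sum] at hpairs
  rw [hsplit]
  linarith

lemma regret_le_two_mul {T : ℕ} {β R : ℝ} {rstar piRef piStar cal : A → ℝ} {r π : ℕ → A → ℝ}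
    (hβ : 0 < β) (hrstar : rstar ∈ rewardClass A R)
    (hRef : piRef ∈ stdSimplex ℝ A) (hRef0 : ∀ a, 0 < piRef a)
    (hs : piStar ∈ stdSimplex ℝ A)
    (hπ : ∀ t, π t ∈ stdSimplex ℝ A) (hkl : β * kl (π 1) piRef ≤ R)
    (hr : ∀ t ∈ Finset.Ico 1 T, r (t + 1) ∈ rewardClass A R)
    (hπmax : ∀ t ∈ Finset.Ico 1 T,
      IsMaxOn (fun p => objJ β piRef p (r (t + 1)) (π t)) (stdSimplex ℝ A) (π (t + 1))) :
    regret T β piRef rstar cal piStar π ≤ T * (2 * R) := by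
  unfold regret
  calc _ ≤ ∑ t ∈ Finset.Icc 1 T, 2 * R := Finset.sum_le_sum fun t ht => ?_
    _ = T * (2 * R) := by simp
  refine objJ_sub_le hβ hRef hRef0 (hπ t) hs hrstar ?_
  rw [Finset.mem_Icc] at ht
  rcases ht.1.eq_or_lt with rfl | h
  · exact hkl
  · have hmem : t - 1 ∈ Finset.Ico 1 T := Finset.mem_Ico.2 ⟨by omega, by omega⟩
    have h1 := hr _ hmem
    have h2 := hπmax _ hmem
    rw [show t - 1 + 1 = t by omega] at h1 h2
    exact mul_kl_le_of_isMaxOn hRef (hπ t) h1 h2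

end Regret

/-! ### Concentration of the log-likelihood -/

section Concentration

variable {Ω : Type*} {m : MeasurableSpace Ω} {μ : Measure Ω} [IsProbabilityMeasure μ]

/-- If `D` takes values in a finite set and has conditional law `q` given `G`, then a function of
`D` with bounded `G`-measurable coefficients is integrated by averaging over `q`. -/
lemma integral_comp_eq_of_condLaw {S : Type*} [Fintype S] {G : MeasurableSpace Ω} (hG : G ≤ m)
    {D : Ω → S} (hD : ∀ o, MeasurableSet[m] {ω | D ω = o}) {q : Ω → S → ℝ}
    (hq : ∀ o, μ[Set.indicator {ω | D ω = o} (fun _ => (1 : ℝ)) | G] =ᵐ[μ] fun ω => q ω o)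
    {f : S → Ω → ℝ} (hf : ∀ o, Measurable[G] (f o)) {c : ℝ} (hc : ∀ o ω, |f o ω| ≤ c) :
    Integrable (fun ω => ∑ o, f o ω * q ω o) μ ∧
      ∫ ω, f (D ω) ω ∂μ = ∫ ω, ∑ o, f o ω * q ω o ∂μ := by
  classical
  set I : S → Ω → ℝ := fun o => Set.indicator {ω | D ω = o} (fun _ => (1 : ℝ)) with hI
  have hIint : ∀ o, Integrable (I o) μ := fun o => (integrable_const 1).indicator (hD o)
  have hfI : ∀ o, Integrable (f o * I o) μ := fun o =>
    (hIint o).bdd_mul ((hf o).mono hG le_rfl).aestronglyMeasurable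
      (Filter.Eventually.of_forall fun ω => hc o ω)
  have hce : ∀ o, μ[f o * I o | G] =ᵐ[μ] fun ω => f o ω * q ω o := by
    intro o
    refine (condExp_mul_of_stronglyMeasurable_left (hf o).stronglyMeasurable (hfI o)
      (hIint o)).trans ?_
    filter_upwards [hq o] with ω hω
    rw [Pi.mul_apply, hω]
  have hint : ∀ o, Integrable (fun ω => f o ω * q ω o) μ := fun o =>
    integrable_condExp.congr (hce o)
  refine ⟨integrable_finsetSum _ fun o _ => hint o, ?_⟩
  have e : (fun ω => f (D ω) ω) = fun ω => ∑ o, (f o * I o) ω := by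
    funext ω
    rw [Finset.sum_eq_single (D ω)]
    · simp [hI]
    · intro o _ ho
      simp [hI, Ne.symm ho]
    · simp
  rw [e, integral_finsetSum _ fun o _ => hfI o, integral_finsetSum _ fun o _ => hint o]
  refine Finset.sum_congr rfl fun o _ => ?_
  rw [← integral_condExp hG, integral_congr_ae (hce o)]

variable {A : Type*}

/-- Half the log-likelihood ratio of `r` against `rstar` for one outcome. -/
noncomputable def halfLogRatio (rstar r : A → ℝ) (o : Sample A) : ℝ :=
  (Real.log (Real.sigmoid (r o.winner - r o.loser)) -
    Real.log (Real.sigmoid (rstar o.winner - rstar o.loser))) / 2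

lemma exp_half_log_ratio_mul {u v : ℝ} (hu : 0 < u) (hv : 0 < v) :
    Real.exp ((Real.log v - Real.log u) / 2) * u = √u * √v := by
  have h1 : Real.exp ((Real.log v - Real.log u) / 2) = √v / √u := by
    rw [Real.exp_half, Real.exp_sub, Real.exp_log hu, Real.exp_log hv, Real.sqrt_div hv.le]
  rw [h1]
  have := Real.sqrt_pos.2 hu
  field_simp
  rw [Real.sq_sqrt hu.le]

lemma logLik_le_of_close {r r' : A → ℝ} {ε : ℝ} (hε : 0 ≤ ε)
    (h : ∀ a b, |(r' a - r' b) - (r a - r b)| ≤ ε) (D : ℕ → Sample A) (t : ℕ) :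
    logLik D t r ≤ logLik D t r' + t * ε := by
  have : (t : ℝ) * ε = ∑ i ∈ Finset.Icc 1 t, ε := by simp
  rw [logLik, logLik, this, ← Finset.sum_add_distrib]
  refine Finset.sum_le_sum fun i _ => log_sigmoid_le hε ?_
  have := (abs_le.1 (h (D i).winner (D i).loser)).1
  linarith

variable [Fintype A]

/-- The Hellinger distance of the comparison laws of `rstar` and `r`, averaged over the pair of
actions of a round. -/
noncomputable def roundGain (rstar p q r : A → ℝ) : ℝ :=
  ∑ a, ∑ b, p a * q b * hellinger (rstar a - rstar b) (r a - r b)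

lemma roundGain_le_one (rstar r : A → ℝ) {p q : A → ℝ} (hp : p ∈ stdSimplex ℝ A)
    (hq : q ∈ stdSimplex ℝ A) : roundGain rstar p q r ≤ 1 := by
  calc roundGain rstar p q r ≤ ∑ a, ∑ b, p a * q b := by
        refine Finset.sum_le_sum fun a _ => Finset.sum_le_sum fun b _ => ?_
        exact mul_le_of_le_one_right (mul_nonneg (hp.1 a) (hq.1 b)) (hellinger_le_one _ _)
    _ = 1 := by simp_rw [← Finset.mul_sum, hq.2, mul_one, hp.2]

lemma sum_exp_halfLogRatio_mul_roundProb (rstar r : A → ℝ) {p q : A → ℝ}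
    (hp : p ∈ stdSimplex ℝ A) (hq : q ∈ stdSimplex ℝ A) :
    ∑ o, Real.exp (halfLogRatio rstar r o) * roundProb rstar p q o =
      1 - roundGain rstar p q r := by
  have h1 : ∀ a b, ∑ c : Bool, Real.exp (halfLogRatio rstar r (a, b, c)) *
      roundProb rstar p q (a, b, c) =
      p a * q b * affinity (rstar a - rstar b) (r a - r b) := by
    intro a b
    have e1 := exp_half_log_ratio_mul (Real.sigmoid_pos (rstar a - rstar b))
      (Real.sigmoid_pos (r a - r b))
    have e2 := exp_half_log_ratio_mul (Real.sigmoid_pos (rstar b - rstar a))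
      (Real.sigmoid_pos (r b - r a))
    simp only [Fintype.sum_bool, halfLogRatio, roundProb, Sample.winner, Sample.loser, if_true,
      Bool.false_eq_true, if_false, affinity, neg_sub]
    linear_combination p a * q b * e1 + p a * q b * e2
  have h2 : ∑ a, ∑ b, p a * q b = 1 := by simp_rw [← Finset.mul_sum, hq.2, mul_one, hp.2]
  rw [Fintype.sum_prod_type]
  simp_rw [Fintype.sum_prod_type, h1, ← h2, roundGain, ← Finset.sum_sub_distrib, hellinger]
  refine Finset.sum_congr rfl fun a _ => Finset.sum_congr rfl fun b _ => ?_
  ring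

/-- The exponential process `exp (½ (ℓ(r) - ℓ(rstar)) + infoGain)`. -/
noncomputable def likProcess (rstar r : A → ℝ) (D : ℕ → Sample A) (π : ℕ → A → ℝ) (t : ℕ) : ℝ :=
  Real.exp ((logLik D t r - logLik D t rstar) / 2 + infoGain rstar π t r)

lemma likProcess_pos (rstar r : A → ℝ) (D : ℕ → Sample A) (π : ℕ → A → ℝ) (t : ℕ) :
    0 < likProcess rstar r D π t := Real.exp_pos _

lemma infoGain_succ (rstar r : A → ℝ) (π : ℕ → A → ℝ) (t : ℕ) :
    infoGain rstar π (t + 1) r = infoGain rstar π t r + roundGain rstar (π t) (π (t + 1)) r := by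
  unfold infoGain roundGain
  simp_rw [← Finset.sum_add_distrib, pairMass_succ, add_mul]

lemma likProcess_zero (rstar r : A → ℝ) (D : ℕ → Sample A) (π : ℕ → A → ℝ) :
    likProcess rstar r D π 0 = 1 := by
  simp [likProcess, logLik, infoGain, pairMass]

lemma likProcess_succ (rstar r : A → ℝ) (D : ℕ → Sample A) (π : ℕ → A → ℝ) (t : ℕ) :
    likProcess rstar r D π (t + 1) = likProcess rstar r D π t *
      Real.exp (halfLogRatio rstar r (D (t + 1)) + roundGain rstar (π t) (π (t + 1)) r) := by
  unfold likProcess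
  rw [← Real.exp_add, infoGain_succ, logLik, logLik, Finset.sum_Icc_succ_top (by omega),
    Finset.sum_Icc_succ_top (by omega), halfLogRatio, logLik, logLik]
  congr 1
  ring

variable {ℱ : Filtration ℕ m} {T : ℕ} {rstar : A → ℝ} {D : ℕ → Ω → Sample A} {π : ℕ → Ω → A → ℝ}

/-- Conditionally on the past, a round multiplies the exponential process on average by
`(1 - g) exp g ≤ 1`, where `g` is the information gain of the round. -/
lemma likProcess_supermartingale
    (hD : ∀ t, 1 ≤ t → t ≤ T → ∀ o, MeasurableSet[ℱ t] {ω | D t ω = o})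
    (hπ : ∀ t ω, π t ω ∈ stdSimplex ℝ A)
    (hπm : ∀ t a, Measurable[ℱ (t - 1)] fun ω => π t ω a)
    (hlaw : ∀ t, 1 ≤ t → t ≤ T → ∀ o,
      μ[Set.indicator {ω | D t ω = o} (fun _ => (1 : ℝ)) | ℱ (t - 1)]
        =ᵐ[μ] fun ω => roundProb rstar (π (t - 1) ω) (π t ω) o) (r : A → ℝ) :
    ∀ t, t ≤ T →
      Measurable[ℱ t] (fun ω => likProcess rstar r (fun i => D i ω) (fun i => π i ω) t) ∧
      (∃ c, ∀ ω, likProcess rstar r (fun i => D i ω) (fun i => π i ω) t ≤ c) ∧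
      ∫ ω, likProcess rstar r (fun i => D i ω) (fun i => π i ω) t ∂μ ≤ 1 := by
  classical
  intro t
  induction t with
  | zero =>
    intro _
    simp only [likProcess_zero]
    exact ⟨measurable_const, ⟨1, fun _ => le_rfl⟩, by simp⟩
  | succ t ih =>
    intro ht
    obtain ⟨hm, ⟨c, hc⟩, hint⟩ := ih (by omega)
    set M : Ω → ℝ := fun ω => likProcess rstar r (fun i => D i ω) (fun i => π i ω) t with hM
    set g : Ω → ℝ := fun ω => roundGain rstar (π t ω) (π (t + 1) ω) r with hg
    have hM0 : ∀ ω, 0 < M ω := fun ω => Real.exp_pos _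
    have hgm : Measurable[ℱ t] g := by
      refine Finset.measurable_fun_sum _ fun a _ => Finset.measurable_fun_sum _ fun b _ => ?_
      have h1 : Measurable[ℱ t] fun ω => π t ω a :=
        (hπm t a).mono (ℱ.mono (Nat.sub_le t 1)) le_rfl
      have h2 : Measurable[ℱ t] fun ω => π (t + 1) ω b := hπm (t + 1) b
      exact (h1.mul h2).mul_const _
    set f : Sample A → Ω → ℝ := fun o ω => M ω * Real.exp (halfLogRatio rstar r o + g ω) with hf
    have hfm : ∀ o, Measurable[ℱ t] (f o) := fun o =>
      hm.mul (Real.measurable_exp.comp (hgm.const_add _))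
    set c' := c * Real.exp (∑ o, |halfLogRatio rstar r o| + 1) with hc'
    have hfc : ∀ o ω, f o ω ≤ c' := by
      intro o ω
      have h1 : |halfLogRatio rstar r o| ≤ ∑ o, |halfLogRatio rstar r o| :=
        Finset.single_le_sum (f := fun o => |halfLogRatio rstar r o|) (fun _ _ => abs_nonneg _)
          (Finset.mem_univ o)
      have h2 := le_abs_self (halfLogRatio rstar r o)
      have h3 : g ω ≤ 1 := roundGain_le_one rstar r (hπ t ω) (hπ (t + 1) ω)
      exact mul_le_mul (hc ω) (Real.exp_le_exp.2 (by linarith)) (Real.exp_pos _).le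
        ((hM0 ω).le.trans (hc ω))
    have hsucc : (fun ω => likProcess rstar r (fun i => D i ω) (fun i => π i ω) (t + 1)) =
        fun ω => f (D (t + 1) ω) ω := by
      funext ω
      rw [likProcess_succ]
    have hDt := hD (t + 1) (by omega) ht
    refine ⟨?_, ⟨c', fun ω => ?_⟩, ?_⟩
    · have e : (fun ω => f (D (t + 1) ω) ω) =
          fun ω => ∑ o, Set.indicator {ω | D (t + 1) ω = o} (f o) ω := by
        funext ω
        rw [Finset.sum_eq_single (D (t + 1) ω)]
        · simp
        · intro o _ ho
          simp [Ne.symm ho]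
        · simp
      rw [hsucc, e]
      exact Finset.measurable_fun_sum _ fun o _ =>
        ((hfm o).mono (ℱ.mono (Nat.le_succ t)) le_rfl).indicator (hDt o)
    · rw [congrFun hsucc ω]
      exact hfc _ ω
    · obtain ⟨h1, h2⟩ := integral_comp_eq_of_condLaw (μ := μ) (ℱ.le t)
        (fun o => ℱ.le (t + 1) _ (hDt o)) (hlaw (t + 1) (by omega) ht) hfm (c := c')
        (fun o ω => by
          rw [abs_of_pos (mul_pos (hM0 ω) (Real.exp_pos _))]; exact hfc o ω)
      rw [hsucc, h2]
      refine le_trans (integral_mono h1 ?_ fun ω => ?_) hint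
      · exact Integrable.of_bound (hm.mono (ℱ.le t) le_rfl).aestronglyMeasurable c
          (Filter.Eventually.of_forall fun ω => by
            rw [Real.norm_of_nonneg (hM0 ω).le]; exact hc ω)
      · have e : ∑ o, f o ω * roundProb rstar (π (t + 1 - 1) ω) (π (t + 1) ω) o =
            M ω * (Real.exp (g ω) * (1 - g ω)) := by
          simp only [Nat.add_sub_cancel, hf, hg]
          rw [← sum_exp_halfLogRatio_mul_roundProb rstar r (hπ t ω) (hπ (t + 1) ω),
            Finset.mul_sum, Finset.mul_sum]
          refine Finset.sum_congr rfl fun o _ => ?_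
          rw [Real.exp_add]; ring
        have h3 : Real.exp (g ω) * (1 - g ω) ≤ 1 := by
          have := Real.one_sub_le_exp_neg (g ω)
          calc _ ≤ Real.exp (g ω) * Real.exp (-g ω) := by gcongr
            _ = 1 := by rw [← Real.exp_add]; simp
        simp only
        rw [e]
        exact mul_le_of_le_one_right (hM0 ω).le h3

lemma measureReal_le_exp_neg
    (hD : ∀ t, 1 ≤ t → t ≤ T → ∀ o, MeasurableSet[ℱ t] {ω | D t ω = o})
    (hπ : ∀ t ω, π t ω ∈ stdSimplex ℝ A)
    (hπm : ∀ t a, Measurable[ℱ (t - 1)] fun ω => π t ω a)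
    (hlaw : ∀ t, 1 ≤ t → t ≤ T → ∀ o,
      μ[Set.indicator {ω | D t ω = o} (fun _ => (1 : ℝ)) | ℱ (t - 1)]
        =ᵐ[μ] fun ω => roundProb rstar (π (t - 1) ω) (π t ω) o) (r : A → ℝ) {t : ℕ} (ht : t ≤ T)
    (L : ℝ) :
    μ.real {ω | L ≤ (logLik (fun i => D i ω) t r - logLik (fun i => D i ω) t rstar) / 2 +
      infoGain rstar (fun i => π i ω) t r} ≤ Real.exp (-L) := by
  obtain ⟨hm, ⟨c, hc⟩, hint⟩ := likProcess_supermartingale (μ := μ) hD hπ hπm hlaw r t ht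
  have hi : Integrable (fun ω => likProcess rstar r (fun i => D i ω) (fun i => π i ω) t) μ :=
    Integrable.of_bound (hm.mono (ℱ.le t) le_rfl).aestronglyMeasurable c
      (Filter.Eventually.of_forall fun ω => by
        rw [Real.norm_of_nonneg (likProcess_pos _ _ _ _ _).le]; exact hc ω)
  have h := mul_meas_ge_le_integral_of_nonneg
    (Filter.Eventually.of_forall fun ω => (likProcess_pos _ _ _ _ _).le) hi (Real.exp L)
  have e : {ω | Real.exp L ≤ likProcess rstar r (fun i => D i ω) (fun i => π i ω) t} =
      {ω | L ≤ (logLik (fun i => D i ω) t r - logLik (fun i => D i ω) t rstar) / 2 +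
      infoGain rstar (fun i => π i ω) t r} := by
    ext ω
    simp [likProcess]
  rw [e] at h
  rw [Real.exp_neg, ← one_div, le_div_iff₀ (Real.exp_pos L)]
  linarith

lemma sum_pairMass {π : ℕ → A → ℝ} (hπ : ∀ t, π t ∈ stdSimplex ℝ A) (t : ℕ) :
    ∑ a, ∑ b, pairMass π t a b = t := by
  induction t with
  | zero => simp [pairMass]
  | succ t ih =>
    simp_rw [pairMass_succ, Finset.sum_add_distrib, ih, ← Finset.mul_sum, (hπ _).2, mul_one,
      (hπ _).2]
    push_cast; ring

lemma infoGain_le_of_close {r r' : A → ℝ} {ε : ℝ} (hε : ε ≤ 1)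
    (h : ∀ a b, |(r' a - r' b) - (r a - r b)| ≤ ε) {π : ℕ → A → ℝ}
    (hπ : ∀ t, π t ∈ stdSimplex ℝ A) (rstar : A → ℝ) (t : ℕ) :
    infoGain rstar π t r ≤ infoGain rstar π t r' + t * ε := by
  rw [← sum_pairMass hπ t, infoGain, infoGain, Finset.sum_mul, ← Finset.sum_add_distrib]
  refine Finset.sum_le_sum fun a _ => ?_
  rw [Finset.sum_mul, ← Finset.sum_add_distrib]
  refine Finset.sum_le_sum fun b _ => ?_
  rw [← mul_add]
  exact mul_le_mul_of_nonneg_left (hellinger_le_of_abs_sub_le hε (h a b)) (pairMass_nonneg hπ t a b)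

/-- Uniform confidence bound, by a union over the rounds and over the rewards with values in the
grid `{k / T : k ≤ T²}`, which approximate every reward with values in `[0, R] ⊆ [0, T]`. -/
theorem measureReal_not_confidence_le [Nonempty A] (hT : 2 ≤ T) {R : ℝ} (hRT : R ≤ T)
    (hD : ∀ t, 1 ≤ t → t ≤ T → ∀ o, MeasurableSet[ℱ t] {ω | D t ω = o})
    (hπ : ∀ t ω, π t ω ∈ stdSimplex ℝ A)
    (hπm : ∀ t a, Measurable[ℱ (t - 1)] fun ω => π t ω a)
    (hlaw : ∀ t, 1 ≤ t → t ≤ T → ∀ o,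
      μ[Set.indicator {ω | D t ω = o} (fun _ => (1 : ℝ)) | ℱ (t - 1)]
        =ᵐ[μ] fun ω => roundProb rstar (π (t - 1) ω) (π t ω) o) :
    μ.real {ω | ¬ ∀ t ∈ Finset.Ico 1 T, ∀ r ∈ rewardClass A R,
      logLik (fun i => D i ω) t r - logLik (fun i => D i ω) t rstar +
        2 * infoGain rstar (fun i => π i ω) t r ≤ 34 * Fintype.card A * Real.log T} ≤
      (T : ℝ) ^ (-10 : ℤ) := by
  classical
  set n := T ^ 2 + 1 with hn
  have hT2 : (2 : ℝ) ≤ T := by exact_mod_cast hT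
  have hT0 : (0 : ℝ) < T := by linarith
  -- This choice makes `T n ^ |A| exp (-L) = T⁻¹⁰`, the sum of the failure probabilities.
  set L := 11 * Real.log T + Fintype.card A * Real.log n with hL
  have hcard : (1 : ℝ) ≤ Fintype.card A := by exact_mod_cast Fintype.card_pos
  have hlogT : 1 / 2 ≤ Real.log T := by
    have := Real.log_two_gt_d9
    have := Real.log_le_log (by norm_num) hT2
    linarith
  have hlogn : Real.log n ≤ 3 * Real.log T := by
    have : 3 * Real.log T = Real.log ((T : ℝ) ^ 3) := by rw [Real.log_pow]; norm_num
    rw [this]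
    apply Real.log_le_log (by positivity)
    rw [hn]; push_cast
    nlinarith [sq_nonneg (T : ℝ)]
  have hLB : 2 * L + 3 ≤ 34 * Fintype.card A * Real.log T := by
    have h1 : Fintype.card A * Real.log n ≤ Fintype.card A * (3 * Real.log T) := by gcongr
    have h2 : 1 * Real.log T ≤ Fintype.card A * Real.log T := by gcongr
    rw [hL]
    linarith
  set grid : (A → Fin n) → A → ℝ := fun g a => (g a : ℕ) / (T : ℝ) with hgrid
  set bad : ℕ × (A → Fin n) → Set Ω := fun x =>
    {ω | L ≤ (logLik (fun i => D i ω) x.1 (grid x.2) - logLik (fun i => D i ω) x.1 rstar) / 2 +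
      infoGain rstar (fun i => π i ω) x.1 (grid x.2)} with hbad
  set s : Finset (ℕ × (A → Fin n)) := Finset.Ico 1 T ×ˢ Finset.univ with hs
  have hsub : {ω | ¬ ∀ t ∈ Finset.Ico 1 T, ∀ r ∈ rewardClass A R,
      logLik (fun i => D i ω) t r - logLik (fun i => D i ω) t rstar +
        2 * infoGain rstar (fun i => π i ω) t r ≤ 34 * Fintype.card A * Real.log T} ⊆
      ⋃ x ∈ s, bad x := by
    intro ω hω
    by_contra hnot
    refine hω fun t ht r hr => ?_
    have htT : (t : ℝ) * (1 / T) ≤ 1 := by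
      rw [mul_one_div, div_le_one hT0]
      exact_mod_cast (Finset.mem_Ico.1 ht).2.le
    have hfl : ∀ a, ⌊T * r a⌋₊ < n := by
      intro a
      rw [hn, Nat.lt_succ_iff]
      refine Nat.floor_le_of_le ?_
      push_cast
      have := (hr a).2
      nlinarith
    set g : A → Fin n := fun a => ⟨⌊T * r a⌋₊, hfl a⟩ with hg
    have hg1 : ∀ a, grid g a ≤ r a ∧ r a ≤ grid g a + 1 / T := by
      intro a
      have h0 : 0 ≤ T * r a := mul_nonneg hT0.le (hr a).1
      have h1 := Nat.floor_le h0
      have h2 := (Nat.lt_floor_add_one (T * r a)).le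
      simp only [hgrid, hg]
      rw [← add_div, div_le_iff₀ hT0, le_div_iff₀ hT0, mul_comm (r a)]
      exact ⟨h1, h2⟩
    have hclose : ∀ a b, |(grid g a - grid g b) - (r a - r b)| ≤ 1 / (T : ℝ) := by
      intro a b
      have h1 := hg1 a
      have h2 := hg1 b
      rw [abs_le]; constructor <;> linarith
    have h1 := logLik_le_of_close (by positivity) hclose (fun i => D i ω) t
    have h2 := infoGain_le_of_close (by rw [div_le_one hT0]; linarith) hclose
      (fun t => hπ t ω) rstar t
    have h3 : ω ∉ bad (t, g) := fun h =>
      hnot (Set.mem_biUnion (Finset.mem_coe.2 (Finset.mem_product.2 ⟨ht, Finset.mem_univ _⟩)) h)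
    have h4 : (logLik (fun i => D i ω) t (grid g) - logLik (fun i => D i ω) t rstar) / 2 +
        infoGain rstar (fun i => π i ω) t (grid g) < L := by
      by_contra h
      exact h3 (not_lt.1 h)
    linarith
  calc _ ≤ μ.real (⋃ x ∈ s, bad x) := measureReal_mono hsub (measure_ne_top _ _)
    _ ≤ ∑ x ∈ s, μ.real (bad x) := measureReal_biUnion_finset_le _ _
    _ ≤ ∑ x ∈ s, Real.exp (-L) := Finset.sum_le_sum fun x hx =>
        measureReal_le_exp_neg hD hπ hπm hlaw _
          (Finset.mem_Ico.1 (Finset.mem_product.1 hx).1).2.le L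
    _ = ((T - 1 : ℕ) : ℝ) * (n : ℝ) ^ Fintype.card A * Real.exp (-L) := by
        rw [Finset.sum_const, nsmul_eq_mul, hs, Finset.card_product, Nat.card_Ico,
          Finset.card_univ, Fintype.card_fun, Fintype.card_fin]
        push_cast; ring
    _ ≤ (T : ℝ) * (n : ℝ) ^ Fintype.card A * Real.exp (-L) := by
        gcongr
        exact_mod_cast Nat.sub_le T 1
    _ = (T : ℝ) ^ (-10 : ℤ) := by
        have hn0 : (0 : ℝ) < n := by positivity
        have e1 : Real.exp L = (T : ℝ) ^ 11 * (n : ℝ) ^ Fintype.card A := by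
          rw [hL, Real.exp_add, Real.exp_nat_mul, Real.exp_log hn0,
            show (11 : ℝ) = ((11 : ℕ) : ℝ) by norm_num, Real.exp_nat_mul, Real.exp_log hT0]
        rw [Real.exp_neg, e1, zpow_neg]
        field_simp

end Concentration

/-! ### The high-probability regret bound -/

section HighProbability

variable {A : Type*} [Fintype A]

lemma pairCost_nonneg {T : ℕ} {β R κ : ℝ} {rstar piRef : A → ℝ} (hR : 0 ≤ R) (hκ : 0 ≤ κ)
    (hRef0 : ∀ a, 0 < piRef a) (p : A × A) : 0 ≤ pairCost T β R κ rstar piRef p := by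
  have h1 := hRef0 p.1
  have h2 := hRef0 p.2
  unfold pairCost
  rw [humanPolicy_div]
  positivity

lemma one_le_sqrt_mul_log {T : ℕ} (hT : 2 ≤ T) : 1 ≤ √(T * Real.log T) := by
  have hT2 : (2 : ℝ) ≤ T := by exact_mod_cast hT
  have h1 := Real.log_two_gt_d9
  have h2 := Real.log_le_log (by norm_num) hT2
  rw [Real.one_le_sqrt]
  nlinarith

/-- The terms produced by `regret_le_of_confidence` are absorbed by those of the final bound. -/
lemma confidence_bound_le {T : ℕ} {β R r₀ : ℝ} {α : ℕ → ℝ} {rstar piRef : A → ℝ} [Nonempty A]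
    (hT : 2 ≤ T) (hr₀ : 0 < r₀) (hR : r₀ ≤ R) (hα0 : ∀ t, 1 ≤ t → t ≤ T → 0 < α t)
    (hRef0 : ∀ a, 0 < piRef a) {C : ℝ} (hC : C = 2 + 34 / r₀ + 2000 * (1 + 1 / r₀)) :
    2 * R + ∑ t ∈ Finset.Ico 1 T, 34 * Fintype.card A * Real.log T / α t +
      2000 * (1 + 1 / r₀) * ∑ p : A × A with rstar p.2 ≤ rstar p.1,
        ((R + Real.log T) * pairCost T β R (α T) rstar piRef p + α T * R ^ 2 + R) ≤
    C * R * (Fintype.card A : ℝ) ^ 2 * √(T * Real.log T)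
      + C * ∑ t ∈ Finset.Icc 1 T, (Fintype.card A : ℝ) * R * Real.log T / α t
      + C * (Fintype.card A : ℝ) ^ 2 * α T * R ^ 2
      + C * (R + Real.log T) *
        ∑ p : A × A with rstar p.2 ≤ rstar p.1, pairCost T β R (α T) rstar piRef p := by
  have hR0 : 0 < R := hr₀.trans_le hR
  have hlogT : 0 ≤ Real.log T := Real.log_natCast_nonneg T
  have hαT : 0 < α T := hα0 T (by omega) le_rfl
  have hsq := one_le_sqrt_mul_log hT
  have hcard : (1 : ℝ) ≤ Fintype.card A := by exact_mod_cast Fintype.card_pos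
  set n : ℝ := (Fintype.card A : ℝ) with hn
  set S := ∑ p : A × A with rstar p.2 ≤ rstar p.1, pairCost T β R (α T) rstar piRef p with hS
  have hS0 : 0 ≤ S := Finset.sum_nonneg fun p _ => pairCost_nonneg hR0.le hαT.le hRef0 p
  set C₀ := 2000 * (1 + 1 / r₀) with hC₀
  have hC₀0 : 0 ≤ C₀ := by positivity
  have hC1 : C₀ + 2 ≤ C := by rw [hC]; linarith [show 0 ≤ 34 / r₀ by positivity]
  have hC2 : 34 / r₀ ≤ C := by rw [hC]; linarith
  have hpairs : ((Finset.univ.filter fun p : A × A => rstar p.2 ≤ rstar p.1).card : ℝ) ≤ n ^ 2 := by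
    have := Finset.card_filter_le (Finset.univ : Finset (A × A)) fun p => rstar p.2 ≤ rstar p.1
    rw [Finset.card_univ, Fintype.card_prod] at this
    rw [hn, sq]
    exact_mod_cast this
  have e1 : ∑ p : A × A with rstar p.2 ≤ rstar p.1,
        ((R + Real.log T) * pairCost T β R (α T) rstar piRef p + α T * R ^ 2 + R) ≤
      (R + Real.log T) * S + n ^ 2 * (α T * R ^ 2 + R) := by
    simp_rw [add_assoc]
    rw [Finset.sum_add_distrib, ← Finset.mul_sum, Finset.sum_const, nsmul_eq_mul]
    have : 0 ≤ α T * R ^ 2 + R := by positivity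
    have := mul_le_mul_of_nonneg_right hpairs this
    linarith
  have e2 : ∑ t ∈ Finset.Ico 1 T, 34 * n * Real.log T / α t ≤
      C * ∑ t ∈ Finset.Icc 1 T, n * R * Real.log T / α t := by
    rw [Finset.mul_sum]
    refine (Finset.sum_le_sum fun t ht => ?_).trans
      (Finset.sum_le_sum_of_subset_of_nonneg Finset.Ico_subset_Icc_self fun t ht _ => ?_)
    · have ht := Finset.mem_Ico.1 ht
      have hαt := hα0 t ht.1 ht.2.le
      have h1 : 34 ≤ C * R := by
        calc (34 : ℝ) = 34 / r₀ * r₀ := by field_simp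
          _ ≤ C * R := mul_le_mul hC2 hR hr₀.le (by linarith)
      rw [← mul_div_assoc]
      have h2 : 34 * (n * Real.log T) ≤ C * R * (n * Real.log T) := by gcongr
      exact div_le_div_of_nonneg_right (by linarith) hαt.le
    · have ht := Finset.mem_Icc.1 ht
      have hαt := hα0 t ht.1 ht.2
      have : 0 ≤ C := by linarith
      positivity
  have e3 : 2 * R + C₀ * (n ^ 2 * R) ≤ C * R * n ^ 2 * √(T * Real.log T) := by
    have h1 : 1 ≤ n ^ 2 := one_le_pow₀ hcard
    have h2 : 0 ≤ C * R * n ^ 2 := by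
      have : 0 ≤ C := by linarith
      positivity
    calc 2 * R + C₀ * (n ^ 2 * R) ≤ 2 * (n ^ 2 * R) + C₀ * (n ^ 2 * R) := by
          gcongr; nlinarith
      _ = (C₀ + 2) * (n ^ 2 * R) := by ring
      _ ≤ C * (n ^ 2 * R) := by gcongr
      _ = C * R * n ^ 2 := by ring
      _ ≤ _ := le_mul_of_one_le_right h2 hsq
  have e4 : C₀ * (n ^ 2 * (α T * R ^ 2)) ≤ C * n ^ 2 * α T * R ^ 2 := by
    calc _ ≤ C * (n ^ 2 * (α T * R ^ 2)) := by gcongr; linarith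
      _ = _ := by ring
  have e5 : C₀ * ((R + Real.log T) * S) ≤ C * (R + Real.log T) * S := by
    rw [mul_assoc C]
    gcongr
    linarith
  have e6 := mul_le_mul_of_nonneg_left e1 hC₀0
  linarith

/-- Since `α T` exceeds `log 2`, rewards beyond the horizon make the third term of the final bound
larger than the total regret. -/
lemma trivial_bound_le {T : ℕ} {β R r₀ : ℝ} {α : ℕ → ℝ} {rstar piRef : A → ℝ} [Nonempty A]
    (hT : 2 ≤ T) (hr₀ : 0 < r₀) (hR : r₀ ≤ R) (hTR : T ≤ R)
    (hα : ∀ t, 1 ≤ t → t ≤ T → (Fintype.card A : ℝ) * Real.log T < α t)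
    (hα0 : ∀ t, 1 ≤ t → t ≤ T → 0 < α t)
    (hRef0 : ∀ a, 0 < piRef a) {C : ℝ} (hC : C = 2 + 34 / r₀ + 2000 * (1 + 1 / r₀)) :
    T * (2 * R) ≤
    C * R * (Fintype.card A : ℝ) ^ 2 * √(T * Real.log T)
      + C * ∑ t ∈ Finset.Icc 1 T, (Fintype.card A : ℝ) * R * Real.log T / α t
      + C * (Fintype.card A : ℝ) ^ 2 * α T * R ^ 2
      + C * (R + Real.log T) *
        ∑ p : A × A with rstar p.2 ≤ rstar p.1, pairCost T β R (α T) rstar piRef p := by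
  have hR0 : 0 < R := hr₀.trans_le hR
  have hlogT : 0 ≤ Real.log T := Real.log_natCast_nonneg T
  have hαT : 0 < α T := hα0 T (by omega) le_rfl
  have hcard : (1 : ℝ) ≤ Fintype.card A := by exact_mod_cast Fintype.card_pos
  have hT2 : (2 : ℝ) ≤ T := by exact_mod_cast hT
  have hαhalf : 1 / 2 ≤ α T := by
    have h1 := Real.log_two_gt_d9
    have h2 := Real.log_le_log (by norm_num) hT2
    have h3 := hα T (by omega) le_rfl
    nlinarith
  have hC0 : 4 ≤ C := by
    have : 0 ≤ 34 / r₀ := by positivity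
    have : 0 ≤ 1 / r₀ := by positivity
    rw [hC]; linarith
  have s1 : 0 ≤ C * R * (Fintype.card A : ℝ) ^ 2 * √(T * Real.log T) := by positivity
  have s2 : 0 ≤ C * ∑ t ∈ Finset.Icc 1 T, (Fintype.card A : ℝ) * R * Real.log T / α t := by
    refine mul_nonneg (by linarith) (Finset.sum_nonneg fun t ht => ?_)
    have ht := Finset.mem_Icc.1 ht
    have := hα0 t ht.1 ht.2
    positivity
  have s3 : 0 ≤ C * (R + Real.log T) *
      ∑ p : A × A with rstar p.2 ≤ rstar p.1, pairCost T β R (α T) rstar piRef p :=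
    mul_nonneg (by positivity)
      (Finset.sum_nonneg fun p _ => pairCost_nonneg hR0.le hαT.le hRef0 p)
  have s4 : T * (2 * R) ≤ C * (Fintype.card A : ℝ) ^ 2 * α T * R ^ 2 := by
    calc T * (2 * R) ≤ R * (2 * R) := by gcongr
      _ = 4 * 1 ^ 2 * (1 / 2) * R ^ 2 := by ring
      _ ≤ _ := by gcongr
  linarith

end HighProbability

end RLHF

theorem theorem1 (r₀ : ℝ) (hr₀ : 0 < r₀) :
    ∃ C K : ℝ, 0 < C ∧ 0 < K ∧
      ∀ (A : Type*) [Fintype A] [Nonempty A]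
        (T : ℕ) (_ : 1 ≤ T)
        (β rmax : ℝ) (_ : 0 < β) (_ : r₀ ≤ rmax)
        (α : ℕ → ℝ)
        (_ : ∀ t, 1 ≤ t → t ≤ T → (Fintype.card A : ℝ) * Real.log T < α t)
        (_ : ∀ s t, 1 ≤ s → s ≤ t → t ≤ T → α s ≤ α t)
        (rstar : A → ℝ) (_ : rstar ∈ rewardClass A rmax)
        (piRef : A → ℝ) (_ : piRef ∈ stdSimplex ℝ A) (_ : ∀ a, 0 < piRef a)
        (piZero : A → ℝ) (_ : piZero ∈ stdSimplex ℝ A)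
        (piOne : A → ℝ) (_ : piOne ∈ stdSimplex ℝ A) (_ : β * kl piOne piRef ≤ rmax)
        (piStar cal : A → ℝ) (_ : cal ∈ stdSimplex ℝ A) (_ : piStar ∈ stdSimplex ℝ A)
        (_ : IsMaxOn (fun p => objJ β piRef p rstar cal) (stdSimplex ℝ A) piStar)
        (Ω : Type*) (m : MeasurableSpace Ω) (μ : Measure Ω) (_ : IsProbabilityMeasure μ)
        (ℱ : Filtration ℕ m) (D : ℕ → Ω → Sample A) (r π : ℕ → Ω → A → ℝ)
        (_ : IsExplorationRun μ ℱ T β rmax α rstar piRef piZero piOne D r π),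
        μ.real {ω | ¬ regret T β piRef rstar cal piStar (fun t => π t ω) ≤
            C * rmax * (Fintype.card A : ℝ) ^ 2 * √(T * Real.log T)
            + C * ∑ t ∈ Finset.Icc 1 T, (Fintype.card A : ℝ) * rmax * Real.log T / α t
            + C * (Fintype.card A : ℝ) ^ 2 * α T * rmax ^ 2
            + C * (rmax + Real.log T) *
              ∑ p : A × A with rstar p.2 ≤ rstar p.1,
                min (humanPolicy rstar p.1 / humanPolicy rstar p.2 * α T * rmax)
                  ((T * (piRef p.2 / piRef p.1)) ^ (β / (β + 1))
                    * α T ^ (1 / (β + 1)) * rmax ^ (1 / (β + 1)))}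
          ≤ K * (T : ℝ) ^ (-10 : ℤ) := by
  obtain ⟨C, hC⟩ : ∃ C, C = 2 + 34 / r₀ + 2000 * (1 + 1 / r₀) := ⟨_, rfl⟩
  refine ⟨C, 1, by rw [hC]; positivity, one_pos, ?_⟩
  intro A _ _ T hT β R hβ hR α hα hαmono rstar hrstar piRef hRef hRef0 piZero hZero piOne hOne hkl
    piStar cal _ hs hstar Ω m μ _ ℱ D r π run
  rw [one_mul]
  -- At `T = 1` the claimed failure probability is `1`.
  rcases hT.eq_or_lt with rfl | hT2
  · simp
  replace hT2 : 2 ≤ T := hT2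
  have hα0 : ∀ t, 1 ≤ t → t ≤ T → 0 < α t := fun t h1 h2 =>
    (mul_nonneg (Nat.cast_nonneg _) (Real.log_natCast_nonneg T)).trans_lt (hα t h1 h2)
  -- Beyond round `T` the run does not constrain the policies, so they are replaced by `piOne`.
  set π' : ℕ → Ω → A → ℝ := fun t ω => if t ≤ T then π t ω else piOne with hπ'
  have hπeq : ∀ t, t ≤ T → π' t = π t := fun t ht => by funext ω; simp [hπ', ht]
  have hreg : ∀ ω, regret T β piRef rstar cal piStar (fun t => π t ω) =
      regret T β piRef rstar cal piStar (fun t => π' t ω) := fun ω =>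
    Finset.sum_congr rfl fun t ht => by simp only [hπeq t (Finset.mem_Icc.1 ht).2]
  have hcases : ∀ t, t = 0 ∨ t = 1 ∨ (∃ s, t = s + 1 ∧ 1 ≤ s ∧ s ≤ T ∧ t ≤ T) ∨ T < t := by
    intro t
    rcases t with _ | _ | s
    · simp
    · simp
    · rcases le_or_gt (s + 2) T with h | h
      · exact Or.inr (Or.inr (Or.inl ⟨s + 1, rfl, by omega, by omega, h⟩))
      · exact Or.inr (Or.inr (Or.inr h))
  have hmem : ∀ t ω, π' t ω ∈ stdSimplex ℝ A := by
    intro t ω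
    rcases hcases t with rfl | rfl | ⟨s, rfl, h1, h2, h3⟩ | h
    · rw [hπeq 0 (by omega), run.init_zero]; exact hZero
    · rw [hπeq 1 (by omega), run.init_one]; exact hOne
    · rw [hπeq _ h3]; exact run.policy_mem s h1 h2 ω
    · simpa [hπ', not_le.2 h] using hOne
  have hmeas : ∀ t a, Measurable[ℱ (t - 1)] fun ω => π' t ω a := by
    intro t a
    rcases hcases t with rfl | rfl | ⟨s, rfl, h1, h2, h3⟩ | h
    · simp only [hπeq 0 (by omega), run.init_zero]; exact measurable_const
    · simp only [hπeq 1 (by omega), run.init_one]; exact measurable_const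
    · simp only [hπeq _ h3]; exact run.policy_meas s h1 h2 a
    · simp only [hπ', not_le.2 h, if_false]; exact measurable_const
  have hlaw : ∀ t, 1 ≤ t → t ≤ T → ∀ o,
      μ[Set.indicator {ω | D t ω = o} (fun _ => (1 : ℝ)) | ℱ (t - 1)]
        =ᵐ[μ] fun ω => roundProb rstar (π' (t - 1) ω) (π' t ω) o := by
    intro t h1 h2 o
    rw [hπeq t h2, hπeq (t - 1) (by omega)]
    exact run.data_law t h1 h2 o
  have hkl' : ∀ ω, β * kl (π' 1 ω) piRef ≤ R := fun ω => by
    rw [hπeq 1 (by omega), run.init_one]; exact hkl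
  have hr : ∀ ω, ∀ t ∈ Finset.Ico 1 T, r (t + 1) ω ∈ rewardClass A R := fun ω t ht =>
    run.reward_mem t (Finset.mem_Ico.1 ht).1 (Finset.mem_Ico.1 ht).2.le ω
  have hπmax : ∀ ω, ∀ t ∈ Finset.Ico 1 T,
      IsMaxOn (fun p => objJ β piRef p (r (t + 1) ω) (π' t ω)) (stdSimplex ℝ A) (π' (t + 1) ω) := by
    intro ω t ht
    have ht' := Finset.mem_Ico.1 ht
    rw [hπeq t ht'.2.le, hπeq (t + 1) ht'.2]
    exact run.policy_max t ht'.1 ht'.2.le ω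
  set bound : ℝ := C * R * (Fintype.card A : ℝ) ^ 2 * √(T * Real.log T)
      + C * ∑ t ∈ Finset.Icc 1 T, (Fintype.card A : ℝ) * R * Real.log T / α t
      + C * (Fintype.card A : ℝ) ^ 2 * α T * R ^ 2
      + C * (R + Real.log T) *
        ∑ p : A × A with rstar p.2 ≤ rstar p.1, pairCost T β R (α T) rstar piRef p with hbound
  change μ.real {ω | ¬ regret T β piRef rstar cal piStar (fun t => π t ω) ≤ bound} ≤ _
  have hconf_le := confidence_bound_le (β := β) (rstar := rstar) hT2 hr₀ hR hα0 hRef0 hC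
  have htriv_le := fun h : T ≤ R =>
    trivial_bound_le (β := β) (rstar := rstar) hT2 hr₀ hR h hα hα0 hRef0 hC
  rw [← hbound] at hconf_le htriv_le
  clear_value bound
  simp only [hreg]
  rcases le_total R T with hRT | hTR
  · have hdet : ∀ ω, (∀ t ∈ Finset.Ico 1 T, ∀ r ∈ rewardClass A R,
        logLik (fun i => D i ω) t r - logLik (fun i => D i ω) t rstar +
          2 * infoGain rstar (fun i => π' i ω) t r ≤ 34 * Fintype.card A * Real.log T) →
        regret T β piRef rstar cal piStar (fun t => π' t ω) ≤ bound := by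
      intro ω hconf
      refine (regret_le_of_confidence (D := fun i => D i ω) (r := fun t => r t ω) hT2 hβ hr₀ hR hα0
        (fun t h1 h2 => hαmono t T h1 h2 le_rfl) hrstar hRef hRef0 hs hstar (fun t => hmem t ω)
        (hkl' ω) (hr ω) (fun t ht => ?_) (hπmax ω)
        (fun t ht => hconf t ht _ (hr ω t ht))).trans hconf_le
      have ht' := Finset.mem_Ico.1 ht
      rw [hπeq t ht'.2.le]
      exact run.reward_max t ht'.1 ht'.2.le ω hrstar
    have hprob := measureReal_not_confidence_le (μ := μ) (ℱ := ℱ) (rstar := rstar) (D := D)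
      (π := π') hT2 hRT run.data_meas hmem hmeas hlaw
    exact (measureReal_mono (Set.ofPred_subset_ofPred.2 fun ω hω hconf => hω (hdet ω hconf))
      (measure_ne_top _ _)).trans hprob
  · have hall : ∀ ω, regret T β piRef rstar cal piStar (fun t => π' t ω) ≤ bound := fun ω =>
      (regret_le_two_mul (r := fun t => r t ω) (π := fun t => π' t ω) hβ hrstar hRef hRef0 hs
        (fun t => hmem t ω) (hkl' ω) (hr ω) (hπmax ω)).trans (htriv_le hTR)
    simp only [hall, not_true_eq_false]
    refine le_trans (le_of_eq ?_) (by positivity : (0 : ℝ) ≤ (T : ℝ) ^ (-10 : ℤ))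
    simp
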